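/- Theorem (Characterization of Morse type foliations). Let $n\ge 2$, let $U\subset\mathbb{C}^n$ be an open neighborhood of the closed unit disk $\overline{D^{2n}}=\{|z|\le 1\}$ and let $\Omega=\sum_{j=1}^n f_j\,dz_j$ be a holomorphic one-form on $U$ which is integrable ($\Omega\wedge d\Omega=0$) and has singular set $\{z\in U:\Omega(z)=0\}=\{0\}$. Let $\mathcal F(\Omega)$ be the holomorphic foliation of $U\setminus\{0\}$ with tangent distribution $\operatorname{Ker}\Omega$, and $\varphi(z)=\sum_j|z_j|^2$. Write $X=(\overline{f_1},\dots,\overline{f_n})$, $JX=\sqrt{-1}\,X$, let $\vec n(z)=z$ be the real radial vector field, $\langle\,,\rangle$ the Euclidean inner product of $\mathbb{R}^{2n}=\mathbb{C}^n$, and on $U\setminus\{0\}$ let $$t_{\mathcal F}(\vec n)=\vec n-\Big[\big\langle\vec n,\tfrac{X}{\|X\|}\big\rangle\tfrac{X}{\|X\|}+\big\langle\vec n,\tfrac{JX}{\|JX\|}\big\rangle\tfrac{JX}{\|JX\|}\Big],$$ which is tangent to the leaves. Let $\Sigma=\{z\in U: 2z=aX(z)+bJX(z)\text{ for some }a,b\in\mathbb{R}\}$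 be the variety of contacts. Outside $0$ it is the real analytic variety with the defining equations $$f_i(z)\,\overline{z_j}-f_j(z)\,\overline{z_i}=0\qquad(1\le i,j\le n).\tag{$*$}$$ The following are equivalent: (i) $\mathcal F(\Omega)$ is of Morse type: for each leaf $L$, each critical point of $\varphi|_L$ is nondegenerate (its real Hessian is nondegenerate). (ii) $\Sigma\setminus\{0\}$, as the real analytic variety defined by $(*)$, is a nonsingular real surface transverse to $\mathcal F(\Omega)$. That is, $\Sigma\setminus\{0\}$ is a (possibly empty) embedded smooth real submanifold of dimension two, its tangent space $T_p\Sigma$ at each of its points $p$ is the common kernel of the real differentials at $p$ of the equations $(*)$, and $T_p\Sigma+T_pL_p=\mathbb{R}^{2n}$, where $L_p$ is the leaf through $p$. (iii) On each leaf $L$, each zero of the vector field $t_{\mathcal F}(\vec n)|_L$ is nondegenerate (its real linear part on $T_pL$ is invertible). -/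

import Mathlib

open Set Filter Topology
open scoped ContDiff ComplexConjugate

namespace MorseFoliation

/-- The space `ℂⁿ`; with its real structure it is the Euclidean space `ℝ²ⁿ`. -/
abbrev Cn (n : ℕ) : Type := EuclideanSpace ℂ (Fin n)

/-! ### Holomorphic one-forms -/

/-- The coefficient `f_j` of `Ω = ∑ f_j dz_j`. -/
noncomputable def coeff {n : ℕ} (Ω : Cn n → (Cn n →L[ℂ] ℂ)) (j : Fin n) (z : Cn n) : ℂ :=
  Ω z (EuclideanSpace.single j 1)

/-- The exterior derivative `dΩ` at `z`, evaluated on `u, v`. -/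
noncomputable def extD {n : ℕ} (Ω : Cn n → (Cn n →L[ℂ] ℂ)) (z u v : Cn n) : ℂ :=
  fderiv ℂ Ω z u v - fderiv ℂ Ω z v u

/-- Integrability `Ω ∧ dΩ = 0` on `U`. -/
def Integrable {n : ℕ} (Ω : Cn n → (Cn n →L[ℂ] ℂ)) (U : Set (Cn n)) : Prop :=
  ∀ z ∈ U, ∀ u v w : Cn n,
    Ω z u * extD Ω z v w + Ω z v * extD Ω z w u + Ω z w * extD Ω z u v = 0

/-- The singular set of `Ω` in `U`. -/
def Sing {n : ℕ} (Ω : Cn n → (Cn n →L[ℂ] ℂ)) (U : Set (Cn n)) : Set (Cn n) :=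
  {z ∈ U | Ω z = 0}

/-! ### The foliation `F(Ω)` and its leaves -/

/-- A plaque of `F(Ω)` in parametrized form: an injective holomorphic immersion `γ` of a connected
open set `V ⊆ ℂⁿ⁻¹` into `U \ Sing Ω` whose image is everywhere tangent to `Ker Ω`. -/
structure IsPlaque {n : ℕ} (Ω : Cn n → (Cn n →L[ℂ] ℂ)) (U : Set (Cn n))
    (V : Set (Cn (n - 1))) (γ : Cn (n - 1) → Cn n) : Prop where
  isOpen : IsOpen V
  isConnected : IsConnected V
  holomorphic : DifferentiableOn ℂ γ V
  injOn : InjOn γ V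
  mapsTo : MapsTo γ V (U \ Sing Ω U)
  immersion : ∀ w ∈ V, Function.Injective (fderiv ℂ γ w)
  tangent : ∀ w ∈ V, ∀ a, Ω (γ w) (fderiv ℂ γ w a) = 0

/-- Two points lie on a common plaque of `F(Ω)`. -/
def SamePlaque {n : ℕ} (Ω : Cn n → (Cn n →L[ℂ] ℂ)) (U : Set (Cn n)) (p q : Cn n) : Prop :=
  ∃ (V : Set (Cn (n - 1))) (γ : Cn (n - 1) → Cn n), IsPlaque Ω U V γ ∧ p ∈ γ '' V ∧ q ∈ γ '' V

/-- The leaf of `F(Ω)` through `p`: all points that a finite chain of plaques joins to `p`. -/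
def leaf {n : ℕ} (Ω : Cn n → (Cn n →L[ℂ] ℂ)) (U : Set (Cn n)) (p : Cn n) : Set (Cn n) :=
  {q | Relation.ReflTransGen (SamePlaque Ω U) p q}

/-- `L` is a leaf of `F(Ω)`. -/
def IsLeaf {n : ℕ} (Ω : Cn n → (Cn n →L[ℂ] ℂ)) (U L : Set (Cn n)) : Prop :=
  ∃ p ∈ U \ Sing Ω U, L = leaf Ω U p

/-- `(V, γ)` is a (connected) local parametrization of the leaf `L`, that is, the inverse of a
chart of the immersed complex submanifold `L`. -/
def IsLeafChart {n : ℕ} (Ω : Cn n → (Cn n →L[ℂ] ℂ)) (U L : Set (Cn n))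
    (V : Set (Cn (n - 1))) (γ : Cn (n - 1) → Cn n) : Prop :=
  IsPlaque Ω U V γ ∧ MapsTo γ V L

/-! ### Morse type -/

/-- `w` is a critical point of the real function `g` (real derivative). -/
def IsCritical {m : ℕ} (g : Cn m → ℝ) (w : Cn m) : Prop :=
  fderiv ℝ g w = 0

/-- The real Hessian of `g` at `w` is a nondegenerate bilinear form. -/
def HessianNondegenerate {m : ℕ} (g : Cn m → ℝ) (w : Cn m) : Prop :=
  ∀ a : Cn m, (∀ b : Cn m, fderiv ℝ (fun x => fderiv ℝ g x) w a b = 0) → a = 0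

/-- The distance function `φ(z) = ∑ |z_j|²`. -/
noncomputable def distFn {n : ℕ} (z : Cn n) : ℝ := ∑ j, ‖z j‖ ^ 2

/-- `F(Ω)` is of Morse type: on each leaf `L`, each critical point `γ w` of `φ|_L` is
nondegenerate, both notions being read in a local parametrization `γ` of the leaf. -/
def IsMorseType {n : ℕ} (Ω : Cn n → (Cn n →L[ℂ] ℂ)) (U : Set (Cn n)) : Prop :=
  ∀ L, IsLeaf Ω U L → ∀ V γ, IsLeafChart Ω U L V γ → ∀ w ∈ V,
    IsCritical (fun x => distFn (γ x)) w → HessianNondegenerate (fun x => distFn (γ x)) w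

/-! ### The projected gradient field -/

/-- The real vector field `X` with `grad Ω = ∑ conj f_j ∂/∂z_j = (X - i J X) / 2`. -/
noncomputable def gradX {n : ℕ} (Ω : Cn n → (Cn n →L[ℂ] ℂ)) (z : Cn n) : Cn n :=
  WithLp.toLp 2 fun j => conj (coeff Ω j z)

/-- The complex structure `J` of `ℂⁿ`. -/
noncomputable def J {n : ℕ} (v : Cn n) : Cn n := Complex.I • v

/-- The natural inner product of `ℝ²ⁿ = ℂⁿ`. -/
noncomputable def realInner {n : ℕ} (u v : Cn n) : ℝ :=
  ∑ j, ((u j).re * (v j).re + (u j).im * (v j).im)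

/-- The field `t_F(n) = n - (⟨n, X/‖X‖⟩ X/‖X‖ + ⟨n, JX/‖JX‖⟩ JX/‖JX‖)`, the projection of the real
radial field `n(z) = z` onto the tangent spaces of `F(Ω)`. -/
noncomputable def projField {n : ℕ} (Ω : Cn n → (Cn n →L[ℂ] ℂ)) (z : Cn n) : Cn n :=
  let X := gradX Ω z
  let e₁ := (‖X‖⁻¹ : ℝ) • X
  let e₂ := (‖J X‖⁻¹ : ℝ) • J X
  z - ((realInner z e₁ : ℝ) • e₁ + (realInner z e₂ : ℝ) • e₂)

/-- A vector field `Y` on `ℂⁿ` that is tangent to a leaf, read in a local parametrization `γ` of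
the leaf: at `w` its value is the vector `ξ` with `Dγ(w) ξ = Y(γ w)`, which is unique as `γ` is an
immersion. -/
noncomputable def leafField {n : ℕ} (γ : Cn (n - 1) → Cn n) (Y : Cn n → Cn n)
    (w : Cn (n - 1)) : Cn (n - 1) :=
  Function.invFun (fderiv ℂ γ w) (Y (γ w))

/-- On each leaf, each singularity (zero) of `t_F(n)`, as a vector field on the leaf, is
nondegenerate: its real linear part there is invertible. -/
def ProjFieldNondegenerate {n : ℕ} (Ω : Cn n → (Cn n →L[ℂ] ℂ)) (U : Set (Cn n)) : Prop :=
  ∀ L, IsLeaf Ω U L → ∀ V γ, IsLeafChart Ω U L V γ → ∀ w ∈ V,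
    leafField γ (projField Ω) w = 0 →
      Function.Bijective (fderiv ℝ (leafField γ (projField Ω)) w)

/-! ### The variety of contacts -/

/-- The variety of contacts `Σ` of `F(Ω)` and the spheres: the points `z` of `U` where
`grad φ (z) = 2 z` equals `a X + b J X` for some real `a, b`. -/
def contactSet {n : ℕ} (Ω : Cn n → (Cn n →L[ℂ] ℂ)) (U : Set (Cn n)) : Set (Cn n) :=
  {z ∈ U | ∃ a b : ℝ, (2 : ℝ) • z = a • gradX Ω z + b • J (gradX Ω z)}

/-- The defining real analytic equations `f_i conj z_j - f_j conj z_i = 0` of `Σ`, that is,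
`f_1 / conj z_1 = ⋯ = f_n / conj z_n`. -/
noncomputable def contactEq {n : ℕ} (Ω : Cn n → (Cn n →L[ℂ] ℂ)) (i j : Fin n) (z : Cn n) : ℂ :=
  coeff Ω i z * conj (z j) - coeff Ω j z * conj (z i)

/-- `S` is an embedded smooth submanifold of real dimension `d` of `ℝ²ⁿ = ℂⁿ`: near each of its
points a local diffeomorphism carries `S` to a real linear subspace of dimension `d`. -/
def IsRealSubmanifold {n : ℕ} (d : ℕ) (S : Set (Cn n)) : Prop :=
  ∀ p ∈ S, ∃ (e : OpenPartialHomeomorph (Cn n) (Cn n)) (W : Submodule ℝ (Cn n)),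
    p ∈ e.source ∧ ContDiffOn ℝ ∞ e e.source ∧ ContDiffOn ℝ ∞ e.symm e.target ∧
    Module.finrank ℝ W = d ∧ e '' (S ∩ e.source) = (W : Set (Cn n)) ∩ e.target

/-- The tangent vectors to `S` at `p`: the velocities at `p` of the curves in `S`. -/
def tangentVectors {n : ℕ} (S : Set (Cn n)) (p : Cn n) : Set (Cn n) :=
  {v | ∃ c : ℝ → Cn n, c 0 = p ∧ HasDerivAt c v 0 ∧ ∀ᶠ t in 𝓝 (0 : ℝ), c t ∈ S}

/-- `Σ \ {0}`, as the real analytic variety given by the contact equations, is a (nonsingular)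
manifold of real dimension two: its points form an embedded surface, whose tangent spaces are cut
out by the differentials of the contact equations. -/
def ContactVarietyIsSurface {n : ℕ} (Ω : Cn n → (Cn n →L[ℂ] ℂ)) (U : Set (Cn n)) : Prop :=
  IsRealSubmanifold 2 (contactSet Ω U \ {0}) ∧
  ∀ p ∈ contactSet Ω U \ {0},
    tangentVectors (contactSet Ω U \ {0}) p = {v | ∀ i j, fderiv ℝ (contactEq Ω i j) p v = 0}

/-- The submanifold `M` is transverse to `F(Ω)`: it misses the singular set, and
`T_p M + T_p L_p = T_p ℂⁿ` for every `p ∈ M`, where `T_p L_p = Ker Ω(p)`. -/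
def IsTransverse {n : ℕ} (Ω : Cn n → (Cn n →L[ℂ] ℂ)) (U M : Set (Cn n)) : Prop :=
  Sing Ω U ∩ M = ∅ ∧
  ∀ p ∈ M, ∀ x : Cn n, ∃ v ∈ tangentVectors M p, ∃ u : Cn n, Ω p u = 0 ∧ v + u = x

end MorseFoliation

/-! All three conditions are local at the contact points `p = c X(p)`, `p ≠ 0`, and each amounts to
one linear condition there, `ContactNondegenerate`: no nonzero `u ∈ Ker Ω(p)` satisfies `u - c DX(p)
u ∈ ℂ X(p)`.

(i) Since `X` is the Hermitian dual of `Ω`, the contact points are the critical points of `φ` on the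
leaves. The field `z - c X(z)`, with `c` frozen, vanishes at `p` and has the same tangential part as
the radial field, so the Hessian of `φ|_L` is `2 Re ⟨u - c DX u, v⟩` on `Ker Ω(p)`
(`IsPlaque.hessianNondegenerate_iff`). Frobenius' theorem (`exists_isPlaque`) provides a leaf chart
at each regular point, without which (i) would carry no information there.

(iii) The projected radial field is half the gradient of `φ|_L` in the induced metric, so at a zero
its linear part represents half the Hessian (`IsPlaque.bijective_fderiv_leafField_iff`).

(ii) The differentials of the contact equations at `p` have common kernel `T = {v | v - c DX v ∈ ℂ
X(p)}`, so the condition says `T ∩ Ker Ω(p) = 0`. If it holds, `contactMap`, which takes values in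
`p^⊥ = Ker Ω(p)`, has a derivative that is injective on `Ker Ω(p)`; the inverse function theorem
then makes `Σ` a surface with tangent plane `T`, a complement of `Ker Ω(p)`. Conversely, if `T` is
the tangent plane of a transverse surface, then the dimensions `2` and `2n - 2` force `T ∩ Ker Ω(p)
= 0`. -/

namespace MorseFoliation

/-! ### Holomorphic maps are smooth, via Cauchy's estimates and integral formula. -/

section Osgood

open Metric

variable {E F : Type*} [NormedAddCommGroup E] [NormedSpace ℂ E]
  [NormedAddCommGroup F] [NormedSpace ℂ F]

/-- Cauchy's estimate for the derivative of a holomorphic map on a ball. -/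
theorem norm_fderiv_le_of_bound {f : E → F} {z : E} {R M : ℝ} (hR : 0 < R)
    (hf : DifferentiableOn ℂ f (ball z R)) (hM : ∀ x ∈ ball z R, ‖f x‖ ≤ M) :
    ‖fderiv ℂ f z‖ ≤ 2 * M / R := by
  refine Complex.norm_fderiv_le_div_of_mapsTo_ball hf (fun x hx => ?_) hR
  rw [mem_closedBall, dist_eq_norm]
  linarith [norm_sub_le (f x) (f z), hM x hx, hM z (mem_ball_self hR)]

/-- The derivative of a bounded holomorphic map is Lipschitz on a smaller ball. -/
theorem norm_fderiv_sub_le_of_bound {f : E → F} {z : E} {R M : ℝ} (hR : 0 < R)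
    (hf : DifferentiableOn ℂ f (ball z (3 * R))) (hM : ∀ x ∈ ball z (3 * R), ‖f x‖ ≤ M)
    {x y : E} (hx : x ∈ ball z R) (hy : y ∈ ball z R) :
    ‖fderiv ℂ f y - fderiv ℂ f x‖ ≤ 2 * (2 * M / R * ‖y - x‖) / R := by
  have hsub : ∀ u : E, u ∈ ball z (2 * R) → ball u R ⊆ ball z (3 * R) := fun u hu =>
    ball_subset_ball' (by rw [mem_ball] at hu; linarith)
  have hopen : ∀ u ∈ ball z (3 * R), DifferentiableAt ℂ f u := fun u hu =>
    hf.differentiableAt (isOpen_ball.mem_nhds hu)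
  have h2 : ball z (2 * R) ⊆ ball z (3 * R) := ball_subset_ball (by linarith)
  have hball : ∀ u ∈ ball x R, u ∈ ball z (2 * R) ∧ u + (y - x) ∈ ball z (2 * R) := by
    intro u hu
    rw [mem_ball] at hx hy hu
    refine ⟨?_, ?_⟩
    · rw [mem_ball]; linarith [dist_triangle u x z]
    · rw [mem_ball]
      have h1 : dist (u + (y - x)) y = dist u x := by
        rw [dist_eq_norm, dist_eq_norm]; congr 1; abel
      linarith [dist_triangle (u + (y - x)) y z]
  -- The translation difference is itself holomorphic and of size `O(‖y - x‖)`, so Cauchy's estimate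
  -- applied to it bounds the difference of the derivatives. Each of the two estimates uses up a
  -- margin `R`, hence the radius `3 * R`.
  have hlip : ∀ u ∈ ball x R, ‖f (u + (y - x)) - f u‖ ≤ 2 * M / R * ‖y - x‖ := by
    intro u hu
    obtain ⟨h3, h4⟩ := hball u hu
    have := (convex_ball z (2 * R)).norm_image_sub_le_of_norm_fderiv_le (𝕜 := ℂ) (f := f)
      (C := 2 * M / R) (fun v hv => hopen v (h2 hv))
      (fun v hv => norm_fderiv_le_of_bound hR (hf.mono (hsub v hv))
        (fun w hw => hM w (hsub v hv hw))) h3 h4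
    simpa using this
  have hg : ∀ u ∈ ball x R, HasFDerivAt (fun u => f (u + (y - x)) - f u)
      (fderiv ℂ f (u + (y - x)) - fderiv ℂ f u) u := fun u hu => by
    have h5 := (hopen _ (h2 (hball u hu).2)).hasFDerivAt
    exact ((hasFDerivAt_comp_add_right (y - x)).2 h5).sub (hopen _ (h2 (hball u hu).1)).hasFDerivAt
  have := norm_fderiv_le_of_bound hR (f := fun u => f (u + (y - x)) - f u)
    (fun u hu => (hg u hu).differentiableAt.differentiableWithinAt) hlip
  rwa [(hg x (mem_ball_self hR)).fderiv, add_sub_cancel] at this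

/-- Continuity makes `f` locally bounded, and a bounded holomorphic map has a locally Lipschitz
derivative. -/
theorem continuousOn_fderiv_of_differentiableOn {f : E → F} {U : Set E} (hU : IsOpen U)
    (hf : DifferentiableOn ℂ f U) : ContinuousOn (fderiv ℂ f) U := by
  intro z hz
  refine ContinuousAt.continuousWithinAt ?_
  have h1 : ∀ᶠ x in 𝓝 z, x ∈ U ∧ ‖f x‖ < ‖f z‖ + 1 :=
    Filter.Eventually.and (hU.mem_nhds hz)
      ((hf.differentiableAt (hU.mem_nhds hz)).continuousAt.norm.eventually_lt
        continuousAt_const (lt_add_one _))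
  obtain ⟨R', hR', h2⟩ := Metric.eventually_nhds_iff_ball.1 h1
  obtain ⟨R, rfl⟩ : ∃ R, R' = 3 * R := ⟨R' / 3, by ring⟩
  have hR : 0 < R := by linarith
  rw [ContinuousAt, tendsto_iff_norm_sub_tendsto_zero]
  have h3 : Tendsto (fun y => 2 * (2 * (‖f z‖ + 1) / R * ‖y - z‖) / R) (𝓝 z) (𝓝 0) := by
    have : ContinuousAt (fun y => 2 * (2 * (‖f z‖ + 1) / R * ‖y - z‖) / R) z := by fun_prop
    simpa [ContinuousAt] using this
  refine squeeze_zero' (Eventually.of_forall fun _ => norm_nonneg _) ?_ h3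
  filter_upwards [ball_mem_nhds z hR] with y hy
  exact norm_fderiv_sub_le_of_bound hR (fun x hx => (hf x (h2 x hx).1).mono fun y hy => (h2 y hy).1)
    (fun x hx => (h2 x hx).2.le) (mem_ball_self hR) hy

variable [CompleteSpace F]

/-- Cauchy's formula on the complex line through `z` in direction `v` writes the derivative as a
circle integral of `f`, which can be differentiated under the integral sign because `fderiv ℂ f` is
locally bounded. -/
theorem differentiableOn_fderiv_apply {f : E → F} {U : Set E} (hU : IsOpen U)
    (hf : DifferentiableOn ℂ f U) (v : E) : DifferentiableOn ℂ (fun z => fderiv ℂ f z v) U := by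
  intro z₀ hz₀
  have hcont := continuousOn_fderiv_of_differentiableOn hU hf
  have h1 : ∀ᶠ x in 𝓝 z₀, x ∈ U ∧ ‖fderiv ℂ f x‖ < ‖fderiv ℂ f z₀‖ + 1 :=
    Filter.Eventually.and (hU.mem_nhds hz₀)
      ((hcont.continuousAt (hU.mem_nhds hz₀)).norm.eventually_lt
        continuousAt_const (lt_add_one _))
  obtain ⟨R, hR, h2⟩ := Metric.eventually_nhds_iff_ball.1 h1
  -- With this radius the disk in direction `v` moves a point by at most `R / 2`, uniformly for `z`
  -- near `z₀`.
  set ρ : ℝ := R / 2 / (‖v‖ + 1) with hρ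
  have hρ0 : 0 < ρ := by positivity
  have hmem : ∀ z ∈ ball z₀ (R / 2), ∀ ζ ∈ closedBall (0 : ℂ) ρ, z + ζ • v ∈ ball z₀ R := by
    intro z hz ζ hζ
    rw [mem_ball, dist_eq_norm] at *
    rw [mem_closedBall, dist_zero_right] at hζ
    have h3 : ‖ζ • v‖ ≤ ρ * ‖v‖ := by rw [norm_smul]; gcongr
    have h4 : ρ * ‖v‖ ≤ R / 2 := by
      rw [hρ, div_mul_eq_mul_div, div_le_iff₀ (by positivity)]
      nlinarith [norm_nonneg v]
    have h5 : z + ζ • v - z₀ = (z - z₀) + ζ • v := by abel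
    rw [h5]
    linarith [norm_add_le (z - z₀) (ζ • v)]
  have hdiff : ∀ x ∈ U, HasFDerivAt f (fderiv ℂ f x) x := fun x hx =>
    (hf.differentiableAt (hU.mem_nhds hx)).hasFDerivAt
  have hform : ∀ z ∈ ball z₀ (R / 2), fderiv ℂ f z v =
      (2 * Real.pi * Complex.I : ℂ)⁻¹ • ∮ ζ in C(0, ρ), (1 / (ζ - 0) ^ 2) • f (z + ζ • v) := by
    intro z hz
    have h3 : ∀ ζ ∈ closedBall (0 : ℂ) ρ,
        HasDerivAt (fun ζ : ℂ => f (z + ζ • v)) (fderiv ℂ f (z + ζ • v) v) ζ := by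
      intro ζ hζ
      have h4 := hdiff _ (h2 _ (hmem z hz ζ hζ)).1
      have h5 : HasDerivAt (fun ζ : ℂ => z + ζ • v) v ζ := by
        simpa using ((hasDerivAt_id ζ).smul_const v).const_add z
      exact h4.comp_hasDerivAt ζ h5
    rw [Complex.differentiable_on_off_countable_deriv_eq_smul_circleIntegral hρ0
      (Set.countable_empty) (fun ζ hζ => (h3 ζ hζ).continuousAt.continuousWithinAt)
      (fun ζ hζ => (h3 ζ (ball_subset_closedBall hζ.1)).differentiableAt),
      (h3 0 (by simp [hρ0.le])).deriv, smul_smul, inv_mul_cancel₀ Complex.two_pi_I_ne_zero,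
      one_smul, zero_smul, add_zero]
  have hev : (fun z => fderiv ℂ f z v) =ᶠ[𝓝 z₀] fun z =>
      (2 * Real.pi * Complex.I : ℂ)⁻¹ • ∮ ζ in C(0, ρ), (1 / (ζ - 0) ^ 2) • f (z + ζ • v) := by
    filter_upwards [ball_mem_nhds z₀ (half_pos hR)] with z hz using hform z hz
  refine (DifferentiableAt.congr_of_eventuallyEq ?_ hev).differentiableWithinAt
  refine DifferentiableAt.const_smul ?_ _
  set c : ℝ → ℂ := fun θ => deriv (circleMap 0 ρ) θ * (1 / (circleMap 0 ρ θ - 0) ^ 2) with hc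
  have hcirc : ∀ θ, circleMap (0 : ℂ) ρ θ ∈ closedBall (0 : ℂ) ρ := fun θ =>
    circleMap_mem_closedBall 0 hρ0.le θ
  have hcc : Continuous c := by
    have h3 : ∀ θ, (circleMap (0 : ℂ) ρ θ - 0) ^ 2 ≠ 0 := fun θ => by
      simp [hρ0.ne']
    simp only [hc, deriv_circleMap]
    exact ((continuous_circleMap 0 ρ).mul continuous_const).mul
      (continuous_const.div (((continuous_circleMap 0 ρ).sub continuous_const).pow 2) h3)
  have hz₀' : z₀ ∈ ball z₀ (R / 2) := mem_ball_self (half_pos hR)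
  have hpath : ∀ z, Continuous fun θ => z + circleMap (0 : ℂ) ρ θ • v := fun z =>
    continuous_const.add ((continuous_circleMap 0 ρ).smul continuous_const)
  have hF : ∀ z ∈ ball z₀ (R / 2),
      Continuous fun θ => c θ • f (z + circleMap (0 : ℂ) ρ θ • v) := fun z hz =>
    hcc.smul (hf.continuousOn.comp_continuous (hpath z)
      fun θ => (h2 _ (hmem z hz _ (hcirc θ))).1)
  have hF' : Continuous fun θ => c θ • fderiv ℂ f (z₀ + circleMap (0 : ℂ) ρ θ • v) :=
    hcc.smul (hcont.comp_continuous (hpath z₀)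
      fun θ => (h2 _ (hmem z₀ hz₀' _ (hcirc θ))).1)
  have key := intervalIntegral.hasFDerivAt_integral_of_dominated_of_fderiv_le
    (𝕜 := ℂ) (μ := MeasureTheory.volume) (a := 0) (b := 2 * Real.pi)
    (F := fun z θ => c θ • f (z + circleMap (0 : ℂ) ρ θ • v))
    (F' := fun z θ => c θ • fderiv ℂ f (z + circleMap (0 : ℂ) ρ θ • v))
    (bound := fun θ => ‖c θ‖ * (‖fderiv ℂ f z₀‖ + 1))
    (ball_mem_nhds z₀ (half_pos hR))
    (by
      filter_upwards [ball_mem_nhds z₀ (half_pos hR)] with z hz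
      exact (hF z hz).aestronglyMeasurable)
    ((hF z₀ hz₀').intervalIntegrable _ _)
    hF'.aestronglyMeasurable
    (Eventually.of_forall fun θ _ z hz => by
      rw [norm_smul]
      gcongr
      exact (h2 _ (hmem z hz _ (hcirc θ))).2.le)
    ((hcc.norm.mul continuous_const).intervalIntegrable _ _)
    (Eventually.of_forall fun θ _ z hz =>
      ((hasFDerivAt_comp_add_right _).2 (hdiff _ (h2 _ (hmem z hz _ (hcirc θ))).1)).const_smul _)
  refine key.differentiableAt.congr_of_eventuallyEq (Eventually.of_forall fun z => ?_)
  simp only [circleIntegral, hc, smul_smul]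

variable [FiniteDimensional ℂ E]

/-- A holomorphic map on an open set of a finite-dimensional space is smooth. -/
theorem contDiffOn_of_differentiableOn {f : E → F} {U : Set E} (hU : IsOpen U)
    (hf : DifferentiableOn ℂ f U) : ContDiffOn ℂ ∞ f U := by
  rw [contDiffOn_infty]
  intro n
  induction n generalizing f with
  | zero => exact contDiffOn_zero.2 hf.continuousOn
  | succ n ih =>
    push_cast
    rw [contDiffOn_succ_iff_fderiv_of_isOpen hU]
    refine ⟨hf, by simp, contDiffOn_clm_apply.2 fun v => ?_⟩
    exact ih (differentiableOn_fderiv_apply hU hf v)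

end Osgood

/-! ### Total differential equations with quantitative bounds. -/

section TotalDifferential

open Metric

/-- The Picard-Lindelöf solution stays in the ball on which the field is controlled. -/
theorem exists_solution_mem_closedBall {E : Type*} [NormedAddCommGroup E] [NormedSpace ℝ E]
    [CompleteSpace E] {f : ℝ → E → E} {tmin tmax : ℝ} {t₀ : Icc tmin tmax} {x₀ : E}
    {a L K : NNReal} (hf : IsPicardLindelof f t₀ x₀ a 0 L K) :
    ∃ α : ℝ → E, α t₀ = x₀ ∧
      (∀ t ∈ Icc tmin tmax, HasDerivWithinAt α (f t (α t)) (Icc tmin tmax) t) ∧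
      ∀ t, α t ∈ closedBall x₀ a := by
  have hx : x₀ ∈ closedBall x₀ ((0 : NNReal) : ℝ) := mem_closedBall_self le_rfl
  obtain ⟨α, hα⟩ := ODE.FunSpace.exists_isFixedPt_next hf hx
  refine ⟨α.compProj, by rw [ODE.FunSpace.compProj_val, ← hα, ODE.FunSpace.next_apply₀],
    fun t ht => ?_, fun t => α.compProj_mem_closedBall hf.mul_max_le⟩
  apply ODE.hasDerivWithinAt_picard_Icc t₀.2 hf.continuousOn_uncurry
    α.continuous_compProj.continuousOn (fun _ ht' => α.compProj_mem_closedBall hf.mul_max_le)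
    x₀ ht |>.congr_of_mem _ ht
  intro t' ht'
  nth_rw 1 [← hα]
  rw [ODE.FunSpace.compProj_of_mem ht', ODE.FunSpace.next_apply]

/-- Gronwall's inequality on `[0, 1]` for a curve starting at the origin. -/
theorem norm_le_mul_exp_of_norm_deriv_le {E : Type*} [NormedAddCommGroup E] [NormedSpace ℝ E]
    {f f' : ℝ → E} {K ε : ℝ} (hK : 1 ≤ K) (hε : 0 ≤ ε)
    (hf : ∀ t ∈ Icc (0 : ℝ) 1, HasDerivWithinAt f (f' t) (Icc 0 1) t) (h0 : f 0 = 0)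
    (bound : ∀ t ∈ Icc (0 : ℝ) 1, ‖f' t‖ ≤ K * ‖f t‖ + ε) :
    ∀ t ∈ Icc (0 : ℝ) 1, ‖f t‖ ≤ ε * Real.exp K := by
  intro t ht
  have h1 := norm_le_gronwallBound_of_norm_deriv_right_le (δ := 0)
    (fun s hs => (hf s hs).continuousWithinAt)
    (fun s hs => (hf s (Ico_subset_Icc_self hs)).mono_of_mem_nhdsWithin
      (Icc_mem_nhdsGE_of_mem hs)) (by simp [h0])
    (fun s hs => bound s (Ico_subset_Icc_self hs)) t ht
  refine h1.trans ?_
  rw [gronwallBound_of_K_ne_0 (by linarith)]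
  have h2 : Real.exp (K * (t - 0)) ≤ Real.exp K := Real.exp_le_exp.2 (by nlinarith [ht.2])
  have h3 : ε / K ≤ ε := div_le_self hε hK
  have h4 : 0 ≤ Real.exp (K * (t - 0)) - 1 := by
    have := Real.one_le_exp (x := K * (t - 0)) (by nlinarith [ht.1])
    linarith
  simp only [zero_mul, zero_add]
  exact mul_le_mul h3 (by linarith) h4 hε

variable {E : Type*} [NormedAddCommGroup E] [NormedSpace ℂ E]

/-- Second order Taylor estimate on a ball where the derivative is Lipschitz. -/
theorem norm_sub_sub_fderiv_le {F : Type*} [NormedAddCommGroup F] [NormedSpace ℂ F]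
    {f : E → F} {f' : E → E →L[ℂ] F} {p : E} {R C : ℝ}
    (hf : ∀ z ∈ closedBall p R, HasFDerivAt f (f' z) z) (hC0 : 0 ≤ C)
    (hC : ∀ a ∈ closedBall p R, ∀ b ∈ closedBall p R, ‖f' b - f' a‖ ≤ C * ‖b - a‖)
    {a b : E} (ha : a ∈ closedBall p R) (hb : b ∈ closedBall p R) :
    ‖f b - f a - f' a (b - a)‖ ≤ C * ‖b - a‖ ^ 2 := by
  -- Intersecting with the ball about `a` turns the Lipschitz bound for `f'` into the constant `C *
  -- ‖b - a‖`.
  have hs : Convex ℝ (closedBall p R ∩ closedBall a ‖b - a‖) :=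
    (convex_closedBall _ _).inter (convex_closedBall _ _)
  have := hs.norm_image_sub_le_of_norm_hasFDerivWithin_le' (𝕜 := ℂ) (f := f) (f' := f')
    (φ := f' a) (C := C * ‖b - a‖) (x := a) (y := b)
    (fun x hx => (hf x hx.1).hasFDerivWithinAt)
    (fun x hx => (hC a ha x hx.1).trans (by
      have := hx.2
      rw [mem_closedBall, dist_eq_norm] at this
      gcongr))
    ⟨ha, by simp⟩ ⟨hb, by simp [dist_eq_norm]⟩
  rwa [mul_assoc, ← pow_two] at this

/-- The Frobenius theorem in the form of a total differential equation: if
`D(Π)(z)(Π(z) u) v` is symmetric in `u, v`, then `Dγ = Π ∘ γ`, `γ(0) = p` has a local solution. -/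
theorem exists_hasFDerivAt_eq_comp_of_bounds [CompleteSpace E] {A : E → E →L[ℂ] E}
    {A' : E → E →L[ℂ] E →L[ℂ] E} {p : E} {R M K C : ℝ} (hR : 0 < R) (hM0 : 0 ≤ M) (hK0 : 0 ≤ K)
    (hC0 : 0 ≤ C)
    (hA : ∀ z ∈ closedBall p R, HasFDerivAt A (A' z) z)
    (hM : ∀ z ∈ closedBall p R, ‖A z‖ ≤ M) (hK : ∀ z ∈ closedBall p R, ‖A' z‖ ≤ K)
    (hC : ∀ a ∈ closedBall p R, ∀ b ∈ closedBall p R, ‖A' b - A' a‖ ≤ C * ‖b - a‖)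
    (hsymm : ∀ z ∈ closedBall p R, ∀ u v, A' z (A z u) v = A' z (A z v) u) :
    ∃ (γ : E → E) (δ : ℝ), 0 < δ ∧ γ 0 = p ∧
      ∀ k ∈ ball 0 δ, γ k ∈ closedBall p R ∧ HasFDerivAt γ (A (γ k)) k := by
  -- For `‖k‖ < δ` the curve `c' = A(c) k` has speed at most `M * δ ≤ R`, so it stays in the ball up
  -- to time `1`. The solution will be `γ k = c k 1`, integration along the ray through `k`.
  set δ : ℝ := R / (M + 1) with hδ
  have hδ0 : 0 < δ := by positivity
  have hlip : ∀ a ∈ closedBall p R, ∀ b ∈ closedBall p R, ‖A b - A a‖ ≤ K * ‖b - a‖ :=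
    fun a ha b hb => (convex_closedBall p R).norm_image_sub_le_of_norm_hasFDerivWithin_le
      (fun x hx => (hA x hx).hasFDerivWithinAt) hK ha hb
  have hsol : ∀ k ∈ ball (0 : E) δ, ∃ c : ℝ → E, c 0 = p ∧
      (∀ t ∈ Icc (0 : ℝ) 1, HasDerivWithinAt c (A (c t) k) (Icc 0 1) t) ∧
      ∀ t, c t ∈ closedBall p R := by
    intro k hk
    rw [mem_ball, dist_zero_right] at hk
    have hPL : IsPicardLindelof (fun _ z => A z k) (tmin := 0) (tmax := 1)
        ⟨0, by simp⟩ p (.mk R hR.le) 0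
        (.mk (M * δ) (by positivity)) (.mk (K * δ) (by positivity)) := by
      refine IsPicardLindelof.of_time_independent (fun x hx => ?_) ?_ ?_
      · exact ((A x).le_of_opNorm_le (hM x hx) k).trans (by simp only [NNReal.coe_mk]; gcongr)
      · refine LipschitzOnWith.of_dist_le_mul fun x hx y hy => ?_
        rw [dist_eq_norm, dist_eq_norm, ← sub_apply]
        refine ((A x - A y).le_of_opNorm_le (hlip y hy x hx) k).trans ?_
        simp only [NNReal.coe_mk]
        rw [mul_right_comm]
        gcongr
      · have : M * δ ≤ R := by
          rw [hδ, mul_div_assoc', div_le_iff₀ (by positivity)]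
          nlinarith
        simpa using this
    obtain ⟨c, h1, h2, h3⟩ := exists_solution_mem_closedBall hPL
    exact ⟨c, h1, h2, h3⟩
  choose! c hc0 hc hcR using hsol
  refine ⟨fun k => c k 1, δ, hδ0, ?_, fun k hk => ⟨hcR k hk 1, ?_⟩⟩
  · have h0 : (0 : E) ∈ ball (0 : E) δ := mem_ball_self hδ0
    have := (constant_of_derivWithin_zero (f := c 0) (a := 0) (b := 1)
      (fun t ht => (hc 0 h0 t ht).differentiableWithinAt) fun t ht => by
        rw [(hc 0 h0 t (Ico_subset_Icc_self ht)).derivWithin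
          (uniqueDiffOn_Icc zero_lt_one t (Ico_subset_Icc_self ht)), map_zero]) 1 (by simp)
    exact this.trans (hc0 0 h0)
  -- The summand `1` meets the requirement `1 ≤ K` of the Gronwall lemma.
  set K' : ℝ := K * δ + 1 with hK'
  have hK'1 : 1 ≤ K' := by have : 0 ≤ K * δ := by positivity
                           linarith
  set G : ℝ := M * Real.exp K' with hG
  have hG0 : 0 ≤ G := by positivity
  have hest : ∀ k' ∈ ball (0 : E) δ, ‖c k' 1 - c k 1 - A (c k 1) (k' - k)‖ ≤
      (K * G + C * G ^ 2 * δ) * Real.exp K' * ‖k' - k‖ ^ 2 := by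
    intro k' hk'
    have hkn : ‖k‖ ≤ δ := by rw [mem_ball, dist_zero_right] at hk; exact hk.le
    have hkn' : ‖k'‖ ≤ δ := by rw [mem_ball, dist_zero_right] at hk'; exact hk'.le
    set v := k' - k with hv
    have hk'v : k' = k + v := by rw [hv]; abel
    have h1 : ∀ t ∈ Icc (0 : ℝ) 1, ‖c k' t - c k t‖ ≤ G * ‖v‖ := by
      intro t ht
      have := norm_le_mul_exp_of_norm_deriv_le (f := fun t => c k' t - c k t) hK'1
        (ε := M * ‖v‖) (by positivity)
        (fun t ht => (hc k' hk' t ht).sub (hc k hk t ht)) (by simp [hc0 k hk, hc0 k' hk'])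
        (fun t ht => by
          have h2 : A (c k' t) k' - A (c k t) k =
              (A (c k' t) - A (c k t)) k' + A (c k t) v := by
            simp only [hv, sub_apply, map_sub]; abel
          have h3 := (A (c k' t) - A (c k t)).le_of_opNorm_le
            (hlip _ (hcR k hk t) _ (hcR k' hk' t)) k'
          have h4 := (A (c k t)).le_of_opNorm_le (hM _ (hcR k hk t)) v
          rw [h2]
          have h5 : K * ‖c k' t - c k t‖ * ‖k'‖ ≤ K * ‖c k' t - c k t‖ * δ := by gcongr
          have h6 := norm_nonneg (c k' t - c k t)
          refine (norm_add_le _ _).trans ?_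
          rw [hK']
          nlinarith) t ht
      calc _ ≤ _ := this
        _ = G * ‖v‖ := by rw [hG]; ring
    -- The expected first variation of `c k t = γ (t k)` in direction `v` is `t A(c k t) v`.
    -- Gronwall's inequality shows that the deviation from it is quadratic in `v`.
    have h7 := norm_le_mul_exp_of_norm_deriv_le
      (f := fun t => c k' t - c k t - t • A (c k t) v)
      (f' := fun t => A (c k' t) k' - A (c k t) k -
        (t • A' (c k t) (A (c k t) k) v + (1 : ℝ) • A (c k t) v)) hK'1
        (ε := (K * G + C * G ^ 2 * δ) * ‖v‖ ^ 2) (by positivity)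
        (fun t ht => by
          refine ((hc k' hk' t ht).sub (hc k hk t ht)).sub ?_
          have h8 : HasDerivWithinAt (fun t => A (c k t) v) (A' (c k t) (A (c k t) k) v)
              (Icc 0 1) t := by
            have h9 : HasFDerivAt (fun z => A z v)
                ((ContinuousLinearMap.apply ℂ E v).comp (A' (c k t))) (c k t) :=
              (ContinuousLinearMap.apply ℂ E v).hasFDerivAt.comp (c k t) (hA _ (hcR k hk t))
            exact (h9.restrictScalars ℝ).comp_hasDerivWithinAt t (hc k hk t ht)
          exact (hasDerivWithinAt_id t _).smul h8) (by simp [hc0 k hk, hc0 k' hk'])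
        (fun t ht => by
          set z := c k t
          set w := c k' t
          have hz : z ∈ closedBall p R := hcR k hk t
          have hw : w ∈ closedBall p R := hcR k' hk' t
          -- Here symmetry enters: it replaces `A' (A k) v` by `A' (A v) k`, leaving two terms
          -- quadratic in `v` and one linear in the deviation.
          have h2 : A w k' - A z k - (t • A' z (A z k) v + (1 : ℝ) • A z v) =
              (A w - A z) v + (A w - A z - A' z (w - z)) k + A' z (w - z - t • A z v) k := by
            rw [hsymm z hz k v, hk'v]
            simp only [sub_apply, map_sub, map_add, one_smul,
              ContinuousLinearMap.map_smul_of_tower, smul_apply]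
            abel
          have h3 := (A w - A z).le_of_opNorm_le (hlip z hz w hw) v
          have h4 := (A w - A z - A' z (w - z)).le_of_opNorm_le
            (norm_sub_sub_fderiv_le hA hC0 hC hz hw) k
          have h5 := (A' z (w - z - t • A z v)).le_of_opNorm_le
            ((A' z).le_of_opNorm_le (hK z hz) _) k
          have h6 : ‖w - z‖ ≤ G * ‖v‖ := h1 t ht
          rw [h2]
          refine (norm_add₃_le).trans ?_
          have h7 : K * ‖w - z‖ * ‖v‖ ≤ K * (G * ‖v‖) * ‖v‖ := by gcongr
          have h8 : C * ‖w - z‖ ^ 2 * ‖k‖ ≤ C * (G * ‖v‖) ^ 2 * δ := by gcongr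
          have h9 : K * ‖w - z - t • A z v‖ * ‖k‖ ≤ K * ‖w - z - t • A z v‖ * δ := by gcongr
          have h10 := norm_nonneg (w - z - t • A z v)
          rw [hK']
          nlinarith) 1 (by simp)
    simp only [one_smul] at h7
    calc _ ≤ _ := h7
      _ = _ := by ring
  have hO : (fun k' => c k' 1 - c k 1 - A (c k 1) (k' - k)) =O[𝓝 k] fun k' => ‖k' - k‖ ^ 2 := by
    refine Asymptotics.IsBigO.of_bound ((K * G + C * G ^ 2 * δ) * Real.exp K') ?_
    filter_upwards [isOpen_ball.mem_nhds hk] with k' hk'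
    simpa using hest k' hk'
  have h1 := hO.hasFDerivAt (𝕜 := ℂ) one_lt_two
  have h2 : HasFDerivAt (fun k' => c k 1 + A (c k 1) (k' - k)) (A (c k 1)) k := by
    have := (A (c k 1)).hasFDerivAt.comp k ((hasFDerivAt_id k).sub_const k)
    simpa using this.const_add (c k 1)
  have h3 := h1.add h2
  rw [zero_add] at h3
  refine h3.congr_of_eventuallyEq (Eventually.of_forall fun k' => ?_)
  simp

end TotalDifferential

/-! ### Frobenius' theorem and the existence of plaques. -/

section Frobenius

open Metric

/-- The Frobenius theorem for a holomorphic total differential equation `Dγ = A ∘ γ`. -/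
theorem exists_hasFDerivAt_eq_comp {E : Type*} [NormedAddCommGroup E] [NormedSpace ℂ E]
    [FiniteDimensional ℂ E] {A : E → E →L[ℂ] E} {N : Set E} (hN : IsOpen N)
    (hA : DifferentiableOn ℂ A N) {p : E} (hp : p ∈ N)
    (hsymm : ∀ z ∈ N, ∀ u v, fderiv ℂ A z (A z u) v = fderiv ℂ A z (A z v) u) :
    ∃ (γ : E → E) (δ : ℝ), 0 < δ ∧ γ 0 = p ∧
      ∀ k ∈ ball 0 δ, γ k ∈ N ∧ HasFDerivAt γ (A (γ k)) k := by
  have : CompleteSpace E := FiniteDimensional.complete ℂ E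
  have hA2 := contDiffOn_of_differentiableOn hN hA
  have hA' : ContDiffAt ℂ 1 (fderiv ℂ A) p :=
    (((contDiffOn_infty_iff_fderiv_of_isOpen hN).1 hA2).2.contDiffAt (hN.mem_nhds hp)).of_le
      (by exact_mod_cast le_top)
  obtain ⟨C, s, hs, hC⟩ := hA'.exists_lipschitzOnWith
  have hcA : ∀ᶠ z in 𝓝 p, ‖A z‖ < ‖A p‖ + 1 :=
    (hA.differentiableAt (hN.mem_nhds hp)).continuousAt.norm.eventually
      (isOpen_Iio.mem_nhds (lt_add_one _))
  have hcA' : ∀ᶠ z in 𝓝 p, ‖fderiv ℂ A z‖ < ‖fderiv ℂ A p‖ + 1 :=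
    ((continuous_norm (E := E →L[ℂ] E →L[ℂ] E)).continuousAt.comp hA'.continuousAt).eventually
      (isOpen_Iio.mem_nhds (lt_add_one _))
  have h1 : ∀ᶠ z in 𝓝 p, (z ∈ N ∧ z ∈ s) ∧ ‖A z‖ < ‖A p‖ + 1 ∧
      ‖fderiv ℂ A z‖ < ‖fderiv ℂ A p‖ + 1 :=
    (Filter.Eventually.and (hN.mem_nhds hp) hs).and (hcA.and hcA')
  obtain ⟨R, hR, h2⟩ := Metric.nhds_basis_closedBall.eventually_iff.1 h1
  obtain ⟨γ, δ, hδ, h0, h3⟩ := exists_hasFDerivAt_eq_comp_of_bounds (A := A)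
    (A' := fderiv ℂ A) (p := p) hR (M := ‖A p‖ + 1) (K := ‖fderiv ℂ A p‖ + 1) (C := C)
    (by positivity) (by positivity) C.2
    (fun z hz => (hA.differentiableAt (hN.mem_nhds (h2 hz).1.1)).hasFDerivAt)
    (fun z hz => (h2 hz).2.1.le) (fun z hz => (h2 hz).2.2.le)
    (fun a ha b hb => hC.norm_sub_le (h2 hb).1.2 (h2 ha).1.2)
    (fun z hz => hsymm z (h2 hz).1.1)
  exact ⟨γ, δ, hδ, h0, fun k hk => ⟨(h2 (h3 k hk).1).1.1, (h3 k hk).2⟩⟩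

variable {n : ℕ} {Ω : Cn n → (Cn n →L[ℂ] ℂ)} {U : Set (Cn n)}

/-- The projection of `ℂⁿ` onto the kernel of the linear form `l` along the vector `q`. -/
noncomputable def projKer (l : Cn n →L[ℂ] ℂ) (q : Cn n) : Cn n →L[ℂ] Cn n :=
  ContinuousLinearMap.id ℂ (Cn n) - (l q)⁻¹ • l.smulRight q

theorem projKer_apply (l : Cn n →L[ℂ] ℂ) (q v : Cn n) :
    projKer l q v = v - ((l q)⁻¹ * l v) • q := by
  simp [projKer, smul_smul]

theorem map_projKer {l : Cn n →L[ℂ] ℂ} {q : Cn n} (h : l q ≠ 0) (v : Cn n) :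
    l (projKer l q v) = 0 := by
  rw [projKer_apply, map_sub, map_smul, smul_eq_mul]
  field_simp
  ring

theorem projKer_self {l : Cn n →L[ℂ] ℂ} {q : Cn n} (h : l q ≠ 0) : projKer l q q = 0 := by
  rw [projKer_apply, inv_mul_cancel₀ h, one_smul, sub_self]

theorem projKer_projKer (l l' : Cn n →L[ℂ] ℂ) {q : Cn n} (h : l q ≠ 0) (v : Cn n) :
    projKer l q (projKer l' q v) = projKer l q v := by
  rw [projKer_apply l', map_sub, map_smul, projKer_self h, smul_zero, sub_zero]

theorem projKer_eq_self {l : Cn n →L[ℂ] ℂ} (q : Cn n) {v : Cn n} (h : l v = 0) :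
    projKer l q v = v := by
  rw [projKer_apply, h, mul_zero, zero_smul, sub_zero]

theorem differentiableAt_projKer {z q : Cn n} (hΩ : DifferentiableAt ℂ Ω z) (hq : Ω z q ≠ 0) :
    DifferentiableAt ℂ (fun z => projKer (Ω z) q) z := by
  have h1 : DifferentiableAt ℂ (fun z => (Ω z q)⁻¹) z :=
    (hΩ.clm_apply (differentiableAt_const q)).inv hq
  have h2 : DifferentiableAt ℂ (fun z => (Ω z).smulRight q) z :=
    ((ContinuousLinearMap.smulRightL ℂ (Cn n) (Cn n)).flip q).differentiableAt.comp z hΩ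
  exact (h1.smul h2).const_sub _

theorem fderiv_projKer_apply {z q : Cn n} (hΩ : DifferentiableAt ℂ Ω z) (hq : Ω z q ≠ 0)
    (w v : Cn n) : fderiv ℂ (fun z => projKer (Ω z) q) z w v =
      -((Ω z q)⁻¹ * fderiv ℂ Ω z w v - (Ω z q ^ 2)⁻¹ * fderiv ℂ Ω z w q * Ω z v) • q := by
  have h0 : ∀ v, HasFDerivAt (fun z => Ω z v)
      ((ContinuousLinearMap.apply ℂ ℂ v).comp (fderiv ℂ Ω z)) z := fun v =>
    (ContinuousLinearMap.apply ℂ ℂ v).hasFDerivAt.comp z hΩ.hasFDerivAt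
  have h1 : HasFDerivAt (fun z => projKer (Ω z) q v)
      ((ContinuousLinearMap.apply ℂ (Cn n) v).comp (fderiv ℂ (fun z => projKer (Ω z) q) z)) z :=
    (ContinuousLinearMap.apply ℂ (Cn n) v).hasFDerivAt.comp z
      (differentiableAt_projKer hΩ hq).hasFDerivAt
  have h2 := (((hasDerivAt_inv hq).comp_hasFDerivAt z (h0 q)).mul (h0 v)).smul_const q
  have h3 := h2.const_sub v
  have h4 := h1.unique (h3.congr_of_eventuallyEq
    (Eventually.of_forall fun z => by simp [projKer_apply]))
  have h5 := congrArg (fun T : Cn n →L[ℂ] Cn n => T w) h4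
  simp only [ContinuousLinearMap.comp_apply, ContinuousLinearMap.apply_apply] at h5
  rw [h5]
  simp only [neg_apply, ContinuousLinearMap.smulRight_apply, ← neg_smul]
  congr 1
  simp
  ring

/-- Both sides are multiples of `q`, and up to a nonvanishing factor their difference is `(Ω ∧
dΩ)(q, u, v)`. -/
theorem projKer_symmetric (hint : Integrable Ω U) {z q : Cn n} (hz : z ∈ U)
    (hΩ : DifferentiableAt ℂ Ω z) (hq : Ω z q ≠ 0) (u v : Cn n) :
    fderiv ℂ (fun z => projKer (Ω z) q) z (projKer (Ω z) q u) v =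
      fderiv ℂ (fun z => projKer (Ω z) q) z (projKer (Ω z) q v) u := by
  rw [fderiv_projKer_apply hΩ hq, fderiv_projKer_apply hΩ hq]
  congr 2
  have h := hint z hz q u v
  simp only [extD] at h
  simp only [projKer_apply, map_sub, map_smul, sub_apply, smul_apply, smul_eq_mul]
  field_simp
  linear_combination (Ω z q) * h

/-- Through each regular point of an integrable holomorphic one-form there passes a plaque. -/
theorem exists_isPlaque (hU : IsOpen U) (hhol : DifferentiableOn ℂ Ω U)
    (hint : Integrable Ω U) {p : Cn n} (hp : p ∈ U) (hΩp : Ω p ≠ 0) :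
    ∃ V γ, IsPlaque Ω U V γ ∧ p ∈ γ '' V := by
  obtain ⟨q, hq⟩ : ∃ q, Ω p q ≠ 0 := by
    by_contra! h
    exact hΩp (ContinuousLinearMap.ext h)
  have hN : IsOpen {z ∈ U | Ω z q ≠ 0} :=
    (hhol.continuousOn.clm_apply continuousOn_const).isOpen_inter_preimage hU isOpen_ne
  set N := {z ∈ U | Ω z q ≠ 0} with hNdef
  have hd : ∀ z ∈ N, DifferentiableAt ℂ Ω z := fun z hz =>
    hhol.differentiableAt (hU.mem_nhds hz.1)
  obtain ⟨γ, δ, hδ, h0, hγ⟩ := exists_hasFDerivAt_eq_comp hN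
    (A := fun z => projKer (Ω z) q)
    (fun z hz => (differentiableAt_projKer (hd z hz) hz.2).differentiableWithinAt)
    (p := p) ⟨hp, hq⟩ (fun z hz => projKer_symmetric hint hz.1 (hd z hz) hz.2)
  have hfin : Module.finrank ℂ (Cn (n - 1)) = Module.finrank ℂ (LinearMap.ker (Ω p).toLinearMap) := by
    have h1 := Module.Dual.finrank_ker_add_one_of_ne_zero (f := (Ω p).toLinearMap)
      (fun h => hΩp (ContinuousLinearMap.coe_injective h))
    rw [finrank_euclideanSpace_fin] at h1 ⊢
    omega
  let e : Cn (n - 1) ≃L[ℂ] LinearMap.ker (Ω p).toLinearMap := ContinuousLinearEquiv.ofFinrankEq hfin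
  let ι : Cn (n - 1) →L[ℂ] Cn n :=
    (LinearMap.ker (Ω p).toLinearMap).subtypeL.comp (e : Cn (n - 1) →L[ℂ] _)
  have hιker : ∀ w, Ω p (ι w) = 0 := fun w => (e w).2
  have hιinj : Function.Injective ι := fun a b h => e.injective (Subtype.ext h)
  have hV : Convex ℝ (ι ⁻¹' ball 0 δ) :=
    (convex_ball (0 : Cn n) δ).linear_preimage (ι.toLinearMap.restrictScalars ℝ)
  have hVo : IsOpen (ι ⁻¹' ball 0 δ) := isOpen_ball.preimage ι.continuous
  have h0V : (0 : Cn (n - 1)) ∈ ι ⁻¹' ball 0 δ := by simp [hδ]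
  have hder : ∀ w ∈ ι ⁻¹' ball 0 δ,
      HasFDerivAt (fun w => γ (ι w)) ((projKer (Ω (γ (ι w))) q).comp ι) w := fun w hw =>
    (hγ _ hw).2.comp w ι.hasFDerivAt
  refine ⟨ι ⁻¹' ball 0 δ, fun w => γ (ι w), ⟨hVo, ⟨⟨0, h0V⟩, hV.isPreconnected⟩,
    fun w hw => (hder w hw).differentiableAt.differentiableWithinAt, ?_, fun w hw => ?_,
    fun w hw => ?_, fun w hw a => ?_⟩, ⟨0, h0V, by simp [h0]⟩⟩
  · intro a ha b hb hab
    -- All the projections are along the same `q`, so projecting the plaque along `q` to `Ker Ω(p)`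
    -- recovers `ι` up to a constant. This makes the plaque a graph over `Ker Ω(p)`, hence
    -- injective.
    have h1 : ∀ w ∈ ι ⁻¹' ball 0 δ,
        HasFDerivAt (fun w => projKer (Ω p) q (γ (ι w)) - ι w) (0 : Cn (n - 1) →L[ℂ] Cn n) w := by
      intro w hw
      have h2 := ((projKer (Ω p) q).hasFDerivAt.comp w (hder w hw)).sub ι.hasFDerivAt
      have h3 : (projKer (Ω p) q).comp ((projKer (Ω (γ (ι w))) q).comp ι) - ι = 0 := by
        ext1 a
        simp [projKer_projKer _ _ hq, projKer_eq_self q (hιker a)]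
      rwa [h3] at h2
    have h2 := hVo.is_const_of_fderiv_eq_zero hV.isPreconnected
      (fun w hw => (h1 w hw).differentiableAt.differentiableWithinAt)
      (fun w hw => (h1 w hw).fderiv) ha hb
    simp only at hab h2
    rw [hab] at h2
    exact hιinj (sub_right_injective h2)
  · obtain ⟨h1, h2⟩ := (hγ _ hw).1
    exact ⟨h1, fun h3 => h2 (by rw [h3.2]; rfl)⟩
  · rw [(hder w hw).fderiv]
    intro a b hab
    have h1 := congrArg (projKer (Ω p) q) hab
    simp only [ContinuousLinearMap.comp_apply, projKer_projKer _ _ hq,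
      projKer_eq_self q (hιker _)] at h1
    exact hιinj h1
  · rw [(hder w hw).fderiv]
    exact map_projKer (hγ _ hw).1.2 _

end Frobenius

/-! ### Linear algebra of `Ω`, `X` and the projected field at a point. -/

section Pointwise

variable {n : ℕ} {Ω : Cn n → (Cn n →L[ℂ] ℂ)} {U : Set (Cn n)}

theorem gradX_apply (z : Cn n) (j : Fin n) : gradX Ω z j = conj (coeff Ω j z) := rfl

/-- The inner product is conjugate linear in its first slot, which undoes the conjugation in
`gradX`. Thus `Ker Ω` is the Hermitian complement of `X`. -/
theorem inner_gradX (z v : Cn n) : inner ℂ (gradX Ω z) v = Ω z v := by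
  have h : v = ∑ j, v j • EuclideanSpace.single j (1 : ℂ) := by
    ext i
    simp [Finset.sum_apply, Pi.single_apply]
  conv_rhs => rw [h]
  simp [PiLp.inner_apply, gradX_apply, coeff]

theorem gradX_eq_zero_iff {z : Cn n} : gradX Ω z = 0 ↔ Ω z = 0 := by
  constructor
  · intro h
    ext v
    rw [← inner_gradX, h]
    simp
  · intro h
    rw [← inner_self_eq_zero (𝕜 := ℂ), inner_gradX, h]
    rfl

theorem contDiffOn_gradX (hU : IsOpen U) (hhol : DifferentiableOn ℂ Ω U) :
    ContDiffOn ℝ ∞ (gradX Ω) U := by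
  have h1 : ContDiffOn ℝ ∞ Ω U := (contDiffOn_of_differentiableOn hU hhol).restrict_scalars ℝ
  rw [contDiffOn_piLp]
  intro j
  have h2 : ContDiff ℝ ∞ fun l : Cn n →L[ℂ] ℂ => conj (l (EuclideanSpace.single j 1)) :=
    (Complex.conjCLE.toContinuousLinearMap.comp ((ContinuousLinearMap.apply ℂ ℂ
      (EuclideanSpace.single j (1 : ℂ) : Cn n)).restrictScalars ℝ)).contDiff
  exact h2.comp_contDiffOn h1

theorem differentiableAt_gradX (hU : IsOpen U) (hhol : DifferentiableOn ℂ Ω U) {z : Cn n}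
    (hz : z ∈ U) : DifferentiableAt ℝ (gradX Ω) z :=
  ((contDiffOn_gradX hU hhol).contDiffAt (hU.mem_nhds hz)).differentiableAt (by simp)

theorem re_inner_self (z : Cn n) : (inner ℂ z z).re = ‖z‖ ^ 2 :=
  inner_self_eq_norm_sq (𝕜 := ℂ) z

theorem realInner_eq (u v : Cn n) : realInner u v = (inner ℂ u v).re := by
  simp only [realInner, PiLp.inner_apply, RCLike.inner_apply, Complex.re_sum]
  refine Finset.sum_congr rfl fun j _ => ?_
  simp
  ring

theorem distFn_eq (z : Cn n) : distFn z = (inner ℂ z z).re := by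
  rw [distFn, re_inner_self, EuclideanSpace.norm_sq_eq]

theorem contactSet_iff {z : Cn n} :
    z ∈ contactSet Ω U ↔ z ∈ U ∧ ∃ c : ℂ, z = c • gradX Ω z := by
  constructor
  · rintro ⟨hz, a, b, h⟩
    refine ⟨hz, (a + b * Complex.I) / 2, ?_⟩
    have h1 : (2 : ℂ) • z = (a + b * Complex.I : ℂ) • gradX Ω z := by
      rw [J] at h
      rw [add_smul, mul_smul, ← Complex.coe_smul, ← Complex.coe_smul] at *
      simpa using h
    rw [div_eq_inv_mul, mul_smul, ← h1, smul_smul]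
    simp
  · rintro ⟨hz, c, h⟩
    refine ⟨hz, 2 * c.re, 2 * c.im, ?_⟩
    have h1 : (2 : ℝ) • z = (2 : ℝ) • ((c.re : ℂ) + c.im * Complex.I) • gradX Ω z := by
      rw [Complex.re_add_im, ← h]
    rw [h1, J, add_smul, mul_smul, smul_add, Complex.coe_smul, Complex.coe_smul, mul_smul, mul_smul]

/-- A vector is orthogonal to `Ker Ω(p)` if and only if it is a multiple of `grad Ω(p)`. -/
theorem forall_re_inner_eq_zero_iff {p y : Cn n} (hp : Ω p ≠ 0) :
    (∀ v, Ω p v = 0 → (inner ℂ y v).re = 0) ↔ ∃ d : ℂ, y = d • gradX Ω p := by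
  have hX : inner ℂ (gradX Ω p) (gradX Ω p) ≠ (0 : ℂ) := by
    rwa [Ne, inner_self_eq_zero, gradX_eq_zero_iff]
  constructor
  · intro h
    set d := inner ℂ (gradX Ω p) y / inner ℂ (gradX Ω p) (gradX Ω p) with hd
    have h1 : inner ℂ (gradX Ω p) (y - d • gradX Ω p) = 0 := by
      rw [inner_sub_right, inner_smul_right, hd, div_mul_cancel₀ _ hX, sub_self]
    have h2 := h (y - d • gradX Ω p) (by rw [← inner_gradX, h1])
    have h3 : inner ℂ (y - d • gradX Ω p) (y - d • gradX Ω p) =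
        inner ℂ y (y - d • gradX Ω p) := by
      rw [inner_sub_left, inner_smul_left, h1, mul_zero, sub_zero]
    have h4 : y - d • gradX Ω p = 0 := by
      rw [← h3, re_inner_self] at h2
      simpa using h2
    exact ⟨d, sub_eq_zero.1 h4⟩
  · rintro ⟨d, rfl⟩ v hv
    rw [inner_smul_left, inner_gradX, hv, mul_zero, Complex.zero_re]

/-- Nondegeneracy of the contact of the leaf with the sphere at `p`, as a condition on the first
jet of `Ω` at `p`. -/
def ContactNondegenerate (Ω : Cn n → (Cn n →L[ℂ] ℂ)) (p : Cn n) : Prop :=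
  ∀ c : ℂ, p = c • gradX Ω p → ∀ u, Ω p u = 0 → ∀ d : ℂ,
    u - c • fderiv ℝ (gradX Ω) p u = d • gradX Ω p → u = 0

/-- The real projections to `X` and `JX` add up to the Hermitian projection to `ℂ X`. -/
theorem projField_eq (z : Cn n) :
    projField Ω z = z - (((‖gradX Ω z‖ ^ 2)⁻¹ : ℝ) * Ω z z : ℂ) • gradX Ω z := by
  have hJ : ‖J (gradX Ω z)‖ = ‖gradX Ω z‖ := by simp [J, norm_smul]
  simp only [projField, hJ, realInner_eq]
  congr 1
  rw [← inner_gradX, ← inner_conj_symm (gradX Ω z) z]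
  generalize gradX Ω z = X
  set r : ℝ := ‖X‖⁻¹ with hr
  have h1 : ∀ Y : Cn n, (r • Y : Cn n) = (r : ℂ) • Y := fun Y => (Complex.coe_smul r Y).symm
  simp only [h1, J, inner_smul_right, smul_smul, ← Complex.coe_smul, ← add_smul]
  congr 1
  rw [← inv_pow, ← hr]
  generalize (inner ℂ z X : ℂ) = s
  apply Complex.ext <;> simp [-Complex.ofReal_pow] <;> ring

theorem map_projField {z : Cn n} (hz : Ω z ≠ 0) : Ω z (projField Ω z) = 0 := by
  have hX : ‖gradX Ω z‖ ≠ 0 := by rwa [Ne, norm_eq_zero, gradX_eq_zero_iff]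
  rw [projField_eq, map_sub, map_smul, ← inner_gradX z (gradX Ω z), inner_self_eq_norm_sq_to_K,
    smul_eq_mul]
  have hX' : (‖gradX Ω z‖ : ℂ) ≠ 0 := by exact_mod_cast hX
  push_cast
  simp only [Complex.coe_algebraMap]
  field_simp
  ring

theorem inner_projField {z v : Cn n} (hv : Ω z v = 0) :
    inner ℂ (projField Ω z) v = inner ℂ z v := by
  rw [projField_eq, inner_sub_left, inner_smul_left, inner_gradX, hv, mul_zero, sub_zero]

theorem differentiableAt_projField (hU : IsOpen U) (hhol : DifferentiableOn ℂ Ω U) {z : Cn n}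
    (hz : z ∈ U) (hΩ : Ω z ≠ 0) : DifferentiableAt ℝ (projField Ω) z := by
  have h1 := differentiableAt_gradX hU hhol hz
  have h2 : DifferentiableAt ℂ (fun z => Ω z z) z :=
    (hhol.differentiableAt (hU.mem_nhds hz)).clm_apply differentiableAt_id
  have h3 : DifferentiableAt ℝ (fun z => ((‖gradX Ω z‖ ^ 2)⁻¹ : ℝ)) z := by
    have h4 : DifferentiableAt ℝ (fun z => (inner ℂ (gradX Ω z) (gradX Ω z)).re) z :=
      Complex.reCLM.differentiableAt.comp z (h1.inner ℂ h1)
    have h5 : (fun z => ‖gradX Ω z‖ ^ 2) = fun z => (inner ℂ (gradX Ω z) (gradX Ω z)).re := by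
      funext z
      rw [re_inner_self]
    refine DifferentiableAt.inv (by rwa [h5]) ?_
    rwa [Ne, sq_eq_zero_iff, norm_eq_zero, gradX_eq_zero_iff]
  have h6 : DifferentiableAt ℝ
      (fun z => (((‖gradX Ω z‖ ^ 2)⁻¹ : ℝ) * Ω z z : ℂ)) z :=
    (Complex.ofRealCLM.differentiableAt.comp z h3).mul (h2.restrictScalars ℝ)
  have h7 : projField Ω = fun z => z - (((‖gradX Ω z‖ ^ 2)⁻¹ : ℝ) * Ω z z : ℂ) • gradX Ω z :=
    funext projField_eq
  rw [h7]
  exact differentiableAt_id.sub (h6.smul h1)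

end Pointwise

/-! ### Critical points, Hessians and the projected field in leaf charts. -/

section Plaque

variable {n : ℕ} {Ω : Cn n → (Cn n →L[ℂ] ℂ)} {U : Set (Cn n)}
  {V : Set (Cn (n - 1))} {γ : Cn (n - 1) → Cn n} {w : Cn (n - 1)}

theorem IsPlaque.mem (h : IsPlaque Ω U V γ) (hw : w ∈ V) : γ w ∈ U := (h.mapsTo hw).1

theorem IsPlaque.regular (h : IsPlaque Ω U V γ) (hw : w ∈ V) : Ω (γ w) ≠ 0 := fun h0 =>
  (h.mapsTo hw).2 ⟨h.mem hw, h0⟩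

theorem IsPlaque.differentiableAt (h : IsPlaque Ω U V γ) (hw : w ∈ V) :
    DifferentiableAt ℂ γ w :=
  h.holomorphic.differentiableAt (h.isOpen.mem_nhds hw)

theorem IsPlaque.contDiffAt (h : IsPlaque Ω U V γ) (hw : w ∈ V) : ContDiffAt ℝ ∞ γ w :=
  ((contDiffOn_of_differentiableOn h.isOpen h.holomorphic).contDiffAt
    (h.isOpen.mem_nhds hw)).restrict_scalars ℝ

theorem IsPlaque.hasFDerivAt_real (h : IsPlaque Ω U V γ) (hw : w ∈ V) :
    HasFDerivAt γ ((fderiv ℂ γ w).restrictScalars ℝ) w :=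
  (h.differentiableAt hw).hasFDerivAt.restrictScalars ℝ

theorem finrank_ker_add_one {l : Cn n →L[ℂ] ℂ} (hl : l ≠ 0) :
    Module.finrank ℂ (LinearMap.ker l.toLinearMap) + 1 = n := by
  have h1 := Module.Dual.finrank_ker_add_one_of_ne_zero (f := l.toLinearMap)
    (fun h => hl (ContinuousLinearMap.coe_injective h))
  rwa [finrank_euclideanSpace_fin] at h1

/-- The tangent space of a plaque is the kernel of `Ω`. -/
theorem IsPlaque.exists_fderiv_eq (h : IsPlaque Ω U V γ) (hw : w ∈ V) {v : Cn n}
    (hv : Ω (γ w) v = 0) : ∃ a, fderiv ℂ γ w a = v := by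
  have h1 : LinearMap.range (fderiv ℂ γ w).toLinearMap = LinearMap.ker (Ω (γ w)).toLinearMap := by
    refine Submodule.eq_of_le_of_finrank_eq ?_ ?_
    · rintro _ ⟨a, rfl⟩
      exact h.tangent w hw a
    · rw [LinearMap.finrank_range_of_inj (h.immersion w hw), finrank_euclideanSpace_fin]
      have := finrank_ker_add_one (h.regular hw)
      omega
  have h2 : v ∈ LinearMap.range (fderiv ℂ γ w).toLinearMap := by
    rw [h1]
    exact hv
  exact h2

theorem hasFDerivAt_re_inner {m : ℕ} {F G : Cn m → Cn n} {F' G' : Cn m →L[ℝ] Cn n} {w : Cn m}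
    (hF : HasFDerivAt F F' w) (hG : HasFDerivAt G G' w) :
    HasFDerivAt (fun x => (inner ℂ (F x) (G x)).re)
      (Complex.reCLM.comp ((fderivInnerCLM ℂ (F w, G w)).comp (F'.prod G'))) w :=
  Complex.reCLM.hasFDerivAt.comp w (hF.inner ℂ hG)

theorem IsPlaque.fderiv_distFn (h : IsPlaque Ω U V γ) (hw : w ∈ V) (b : Cn (n - 1)) :
    fderiv ℝ (fun x => distFn (γ x)) w b = 2 * (inner ℂ (γ w) (fderiv ℂ γ w b)).re := by
  have h1 := hasFDerivAt_re_inner (h.hasFDerivAt_real hw) (h.hasFDerivAt_real hw)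
  simp only [← distFn_eq] at h1
  rw [h1.fderiv]
  have h2 : (inner ℂ (fderiv ℂ γ w b) (γ w)).re = (inner ℂ (γ w) (fderiv ℂ γ w b)).re :=
    inner_re_symm (𝕜 := ℂ) _ _
  simp [fderivInnerCLM_apply, h2, two_mul]

/-- Critical points of the distance function on a leaf are the contacts with the spheres. -/
theorem IsPlaque.isCritical_iff (h : IsPlaque Ω U V γ) (hw : w ∈ V) :
    IsCritical (fun x => distFn (γ x)) w ↔ ∃ c : ℂ, γ w = c • gradX Ω (γ w) := by
  rw [← forall_re_inner_eq_zero_iff (h.regular hw)]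
  constructor
  · intro h1 v hv
    obtain ⟨a, rfl⟩ := h.exists_fderiv_eq hw hv
    have := h.fderiv_distFn hw a
    rw [IsCritical] at h1
    rw [h1] at this
    simpa using this.symm
  · intro h1
    refine ContinuousLinearMap.ext fun b => ?_
    rw [h.fderiv_distFn hw, h1 _ (h.tangent w hw b)]
    simp

theorem IsPlaque.differentiableAt_fderiv_apply (h : IsPlaque Ω U V γ) (hw : w ∈ V)
    (b : Cn (n - 1)) : DifferentiableAt ℝ (fun x => fderiv ℂ γ x b) w :=
  ((differentiableOn_fderiv_apply h.isOpen h.holomorphic b).differentiableAt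
    (h.isOpen.mem_nhds hw)).restrictScalars ℝ

/-- The Hessian of the distance function at a zero of a field `H` which has the same tangential
component as the radial field. -/
theorem IsPlaque.hessian_distFn (h : IsPlaque Ω U V γ) (hw : w ∈ V) {H : Cn (n - 1) → Cn n}
    {H' : Cn (n - 1) →L[ℝ] Cn n} (hH : HasFDerivAt H H' w) (h0 : H w = 0)
    (heq : ∀ x ∈ V, ∀ b, (inner ℂ (γ x) (fderiv ℂ γ x b)).re =
      (inner ℂ (H x) (fderiv ℂ γ x b)).re) (a b : Cn (n - 1)) :
    fderiv ℝ (fun x => fderiv ℝ (fun x => distFn (γ x)) x) w a b =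
      2 * (inner ℂ (H' a) (fderiv ℂ γ w b)).re := by
  have hg : ContDiffAt ℝ ∞ (fun x => distFn (γ x)) w := by
    simp only [distFn_eq]
    exact Complex.reCLM.contDiff.contDiffAt.comp w ((h.contDiffAt hw).inner ℂ (h.contDiffAt hw))
  have hg1 : DifferentiableAt ℝ (fun x => fderiv ℝ (fun x => distFn (γ x)) x) w :=
    (hg.fderiv_right ENat.coe_top_add_one.le).differentiableAt (by simp)
  have h1 : HasFDerivAt (fun x => fderiv ℝ (fun x => distFn (γ x)) x b)
      ((ContinuousLinearMap.apply ℝ ℝ b).comp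
        (fderiv ℝ (fun x => fderiv ℝ (fun x => distFn (γ x)) x) w)) w :=
    (ContinuousLinearMap.apply ℝ ℝ b).hasFDerivAt.comp w hg1.hasFDerivAt
  have h2 := (hasFDerivAt_re_inner hH (h.differentiableAt_fderiv_apply hw b).hasFDerivAt).const_mul
    (2 : ℝ)
  have h3 : (fun x => fderiv ℝ (fun x => distFn (γ x)) x b) =ᶠ[𝓝 w]
      fun x => 2 * (inner ℂ (H x) (fderiv ℂ γ x b)).re := by
    filter_upwards [h.isOpen.mem_nhds hw] with x hx
    rw [h.fderiv_distFn hx, heq x hx]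
  have h4 := congrArg (fun T : Cn (n - 1) →L[ℝ] ℝ => T a) (h1.unique (h2.congr_of_eventuallyEq h3))
  -- The term with the second derivative of `γ` is paired with `H w = 0` and drops out.
  simpa [fderivInnerCLM_apply, h0] using h4

/-- At a contact point, nondegeneracy of the Hessian is a condition on the first jet of `Ω`. -/
theorem IsPlaque.hessianNondegenerate_iff (hU : IsOpen U) (hhol : DifferentiableOn ℂ Ω U)
    (h : IsPlaque Ω U V γ) (hw : w ∈ V) {c : ℂ} (hc : γ w = c • gradX Ω (γ w)) :
    HessianNondegenerate (fun x => distFn (γ x)) w ↔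
      ∀ u, Ω (γ w) u = 0 → ∀ d : ℂ,
        u - c • fderiv ℝ (gradX Ω) (γ w) u = d • gradX Ω (γ w) → u = 0 := by
  have hX := (differentiableAt_gradX hU hhol (h.mem hw)).hasFDerivAt
  have hH : HasFDerivAt (fun x => γ x - c • gradX Ω (γ x))
      ((fderiv ℂ γ w).restrictScalars ℝ -
        c • (fderiv ℝ (gradX Ω) (γ w)).comp ((fderiv ℂ γ w).restrictScalars ℝ)) w :=
    (h.hasFDerivAt_real hw).sub ((hX.comp w (h.hasFDerivAt_real hw)).const_smul c)
  have hess := h.hessian_distFn hw hH (sub_eq_zero.2 hc) fun x hx b => by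
    rw [inner_sub_left, inner_smul_left, inner_gradX, h.tangent x hx, mul_zero, sub_zero]
  have key : ∀ a, (∀ b, fderiv ℝ (fun x => fderiv ℝ (fun x => distFn (γ x)) x) w a b = 0) ↔
      ∃ d : ℂ, fderiv ℂ γ w a - c • fderiv ℝ (gradX Ω) (γ w) (fderiv ℂ γ w a) =
        d • gradX Ω (γ w) := by
    intro a
    rw [← forall_re_inner_eq_zero_iff (h.regular hw)]
    constructor
    · intro h1 v hv
      obtain ⟨b, rfl⟩ := h.exists_fderiv_eq hw hv
      simpa [hess] using h1 b
    · intro h1 b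
      simpa [hess] using h1 _ (h.tangent w hw b)
  constructor
  · intro h1 u hu d hd
    obtain ⟨a, rfl⟩ := h.exists_fderiv_eq hw hu
    rw [h1 a ((key a).2 ⟨d, hd⟩), map_zero]
  · intro h1 a ha
    obtain ⟨d, hd⟩ := (key a).1 ha
    exact h.immersion w hw (by rw [h1 _ (h.tangent w hw a) d hd, map_zero])

theorem mem_leaf_of_isPlaque (h : IsPlaque Ω U V γ) {x y : Cn (n - 1)} (hx : x ∈ V) (hy : y ∈ V) :
    γ y ∈ leaf Ω U (γ x) :=
  Relation.ReflTransGen.single ⟨V, γ, h, ⟨x, hx, rfl⟩, ⟨y, hy, rfl⟩⟩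

/-- Morse type means nondegenerate contact with the spheres at each point of contact. -/
theorem isMorseType_iff (hU : IsOpen U) (hhol : DifferentiableOn ℂ Ω U) (hint : Integrable Ω U) :
    IsMorseType Ω U ↔ ∀ p ∈ contactSet Ω U, Ω p ≠ 0 → ContactNondegenerate Ω p := by
  constructor
  · intro hM p hp hΩ c hc
    obtain ⟨V, γ, h, w, hw, rfl⟩ := exists_isPlaque hU hhol hint (contactSet_iff.1 hp).1 hΩ
    have := hM (leaf Ω U (γ w)) ⟨γ w, h.mapsTo hw, rfl⟩ V γ
      ⟨h, fun y hy => mem_leaf_of_isPlaque h hw hy⟩ w hw ((h.isCritical_iff hw).2 ⟨c, hc⟩)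
    exact (h.hessianNondegenerate_iff hU hhol hw hc).1 this
  · rintro hN L - V γ ⟨h, -⟩ w hw hcrit
    obtain ⟨c, hc⟩ := (h.isCritical_iff hw).1 hcrit
    exact (h.hessianNondegenerate_iff hU hhol hw hc).2
      (hN _ (contactSet_iff.2 ⟨h.mem hw, c, hc⟩) (h.regular hw) c hc)

theorem IsPlaque.fderiv_leafField (h : IsPlaque Ω U V γ) (hw : w ∈ V) :
    fderiv ℂ γ w (leafField γ (projField Ω) w) = projField Ω (γ w) :=
  Function.invFun_eq (h.exists_fderiv_eq hw (map_projField (h.regular hw)))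

/-- With `B` a left inverse of `Dγ(w)`, the operator `T x = B ∘ Dγ(x)` is the identity at `w`, hence
invertible nearby, and the field equals `T⁻¹ B (projField ∘ γ)` there. -/
theorem IsPlaque.differentiableAt_leafField (hU : IsOpen U) (hhol : DifferentiableOn ℂ Ω U)
    (h : IsPlaque Ω U V γ) (hw : w ∈ V) :
    DifferentiableAt ℝ (leafField γ (projField Ω)) w := by
  obtain ⟨B₀, hB₀⟩ := (fderiv ℂ γ w).toLinearMap.exists_leftInverse_of_injective
    (LinearMap.ker_eq_bot.2 (h.immersion w hw))
  set B := LinearMap.toContinuousLinearMap B₀ with hB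
  set T : Cn (n - 1) → (Cn (n - 1) →L[ℂ] Cn (n - 1)) := fun x => B.comp (fderiv ℂ γ x) with hT
  have hTw : T w = 1 := by
    ext1 a
    exact congrArg (fun f : Cn (n - 1) →ₗ[ℂ] Cn (n - 1) => f a) hB₀
  have hγ' : DifferentiableAt ℂ (fderiv ℂ γ) w :=
    ((contDiffOn_of_differentiableOn h.isOpen h.holomorphic).contDiffAt
      (h.isOpen.mem_nhds hw)).fderiv_right ENat.coe_top_add_one.le
      |>.differentiableAt (by simp)
  have hTd : DifferentiableAt ℂ T w :=
    (ContinuousLinearMap.compL ℂ (Cn (n - 1)) (Cn n) (Cn (n - 1)) B).differentiableAt.comp w hγ'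
  have hTi : DifferentiableAt ℝ (fun x => Ring.inverse (T x)) w :=
    (DifferentiableAt.inverse hTd (by rw [hTw]; exact isUnit_one)).restrictScalars ℝ
  have hunit : ∀ᶠ x in 𝓝 w, IsUnit (T x) :=
    hTd.continuousAt.eventually (Units.isOpen.mem_nhds (by rw [hTw]; exact isUnit_one))
  have hev : leafField γ (projField Ω) =ᶠ[𝓝 w]
      fun x => Ring.inverse (T x) (B (projField Ω (γ x))) := by
    filter_upwards [hunit, h.isOpen.mem_nhds hw] with x hx hxV
    rw [← h.fderiv_leafField hxV]
    have h1 : Ring.inverse (T x) * T x = 1 := Ring.inverse_mul_cancel _ hx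
    exact (congrArg (fun S : Cn (n - 1) →L[ℂ] Cn (n - 1) => S (leafField γ (projField Ω) x)) h1).symm
  refine DifferentiableAt.congr_of_eventuallyEq ?_ hev
  have h2 : DifferentiableAt ℝ (fun x => B (projField Ω (γ x))) w :=
    (B.restrictScalars ℝ).differentiableAt.comp w
      ((differentiableAt_projField hU hhol (h.mem hw) (h.regular hw)).comp w
        (h.hasFDerivAt_real hw).differentiableAt)
  have h3 : DifferentiableAt ℝ (fun x => (Ring.inverse (T x)).restrictScalars ℝ) w :=
    (ContinuousLinearMap.restrictScalarsL ℂ (Cn (n - 1)) (Cn (n - 1)) ℝ ℝ).differentiableAt.comp w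
      hTi
  exact h3.clm_apply h2

/-- In view of `IsPlaque.fderiv_distFn`, this makes the field half the gradient of `φ ∘ γ` in the
metric pulled back by `γ`. -/
theorem IsPlaque.re_inner_leafField (h : IsPlaque Ω U V γ) (hw : w ∈ V) (b : Cn (n - 1)) :
    (inner ℂ (γ w) (fderiv ℂ γ w b)).re =
      (inner ℂ (fderiv ℂ γ w (leafField γ (projField Ω) w)) (fderiv ℂ γ w b)).re := by
  rw [h.fderiv_leafField hw, inner_projField (h.tangent w hw b)]

theorem IsPlaque.eq_zero_of_re_inner (h : IsPlaque Ω U V γ) (hw : w ∈ V) {a : Cn (n - 1)}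
    (ha : ∀ b, (inner ℂ (fderiv ℂ γ w a) (fderiv ℂ γ w b)).re = 0) : a = 0 := by
  have h1 := ha a
  rw [re_inner_self] at h1
  exact h.immersion w hw (by simpa using h1)

theorem IsPlaque.leafField_eq_zero_iff (h : IsPlaque Ω U V γ) (hw : w ∈ V) :
    leafField γ (projField Ω) w = 0 ↔ IsCritical (fun x => distFn (γ x)) w := by
  constructor
  · intro h1
    refine ContinuousLinearMap.ext fun b => ?_
    rw [h.fderiv_distFn hw, h.re_inner_leafField hw, h1]
    simp
  · intro h1
    refine h.eq_zero_of_re_inner hw fun b => ?_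
    have := h.fderiv_distFn hw b
    rw [IsCritical] at h1
    rw [h1, h.re_inner_leafField hw] at this
    simpa using this.symm

/-- At a zero the Hessian is `2 Re ⟨Dγ (ξ' a), Dγ b⟩`. The pulled-back metric is definite, so the
Hessian and `ξ'` have the same kernel. -/
theorem IsPlaque.bijective_fderiv_leafField_iff (hU : IsOpen U) (hhol : DifferentiableOn ℂ Ω U)
    (h : IsPlaque Ω U V γ) (hw : w ∈ V) (h0 : leafField γ (projField Ω) w = 0) :
    Function.Bijective (fderiv ℝ (leafField γ (projField Ω)) w) ↔
      HessianNondegenerate (fun x => distFn (γ x)) w := by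
  have hξ := (h.differentiableAt_leafField hU hhol hw).hasFDerivAt
  set ξ := leafField γ (projField Ω) with hξdef
  have hγ' : DifferentiableAt ℝ (fun x => fderiv ℝ γ x) w :=
    (h.contDiffAt hw).fderiv_right ENat.coe_top_add_one.le
      |>.differentiableAt (by simp)
  have hreal : ∀ x ∈ V, ∀ a, fderiv ℝ γ x a = fderiv ℂ γ x a := fun x hx a => by
    rw [(h.hasFDerivAt_real hx).fderiv]
    rfl
  have hess := h.hessian_distFn hw (hγ'.hasFDerivAt.clm_apply hξ) (by simp [h0])
    fun x hx b => by rw [hreal x hx, h.re_inner_leafField hx]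
  have hess' : ∀ a b, fderiv ℝ (fun x => fderiv ℝ (fun x => distFn (γ x)) x) w a b =
      2 * (inner ℂ (fderiv ℂ γ w (fderiv ℝ ξ w a)) (fderiv ℂ γ w b)).re := fun a b => by
    rw [hess, ← hreal w hw (fderiv ℝ ξ w a)]
    simp [h0]
  have hinj : Function.Bijective (fderiv ℝ ξ w) ↔ Function.Injective (fderiv ℝ ξ w) :=
    ⟨fun h => h.1, fun h1 => ⟨h1, LinearMap.injective_iff_surjective
      (f := (fderiv ℝ ξ w).toLinearMap).1 h1⟩⟩
  rw [hinj, injective_iff_map_eq_zero]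
  refine forall_congr' fun a => ?_
  simp only [hess']
  constructor
  · intro h1 h2
    exact h1 (h.eq_zero_of_re_inner hw fun b => by simpa using h2 b)
  · intro h1 h2
    exact h1 fun b => by simp [h2]

theorem isMorseType_iff_projFieldNondegenerate (hU : IsOpen U) (hhol : DifferentiableOn ℂ Ω U) :
    IsMorseType Ω U ↔ ProjFieldNondegenerate Ω U := by
  refine forall₄_congr fun L _ V γ => forall₃_congr fun h w hw => ?_
  rw [h.1.leafField_eq_zero_iff hw]
  refine forall_congr' fun hcrit => ?_
  rw [h.1.bijective_fderiv_leafField_iff hU hhol hw ((h.1.leafField_eq_zero_iff hw).2 hcrit)]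

end Plaque

/-! ### Differentials of the contact equations and a chart flattening `Σ`. -/

section Surface

variable {n : ℕ} {Ω : Cn n → (Cn n →L[ℂ] ℂ)} {U : Set (Cn n)} {p : Cn n} {c : ℂ}

/-- The equations are the conjugates of the `2 × 2` minors of `(X, z)`. Substituting `p = c X(p)` in
the product rule leaves the minors of `(c DX v - v, X)`. -/
theorem fderiv_contactEq (hX : DifferentiableAt ℝ (gradX Ω) p) (hc : p = c • gradX Ω p)
    (i j : Fin n) (v : Cn n) :
    fderiv ℝ (contactEq Ω i j) p v =
      conj ((c • fderiv ℝ (gradX Ω) p v - v) i * gradX Ω p j -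
        (c • fderiv ℝ (gradX Ω) p v - v) j * gradX Ω p i) := by
  have hco : ∀ i, HasFDerivAt (fun z : Cn n => z i)
      ((EuclideanSpace.proj (𝕜 := ℂ) i).restrictScalars ℝ) p := fun i =>
    ((EuclideanSpace.proj (𝕜 := ℂ) i).restrictScalars ℝ).hasFDerivAt
  have hXi : ∀ i, HasFDerivAt (fun z => gradX Ω z i)
      (((EuclideanSpace.proj (𝕜 := ℂ) i).restrictScalars ℝ).comp (fderiv ℝ (gradX Ω) p)) p :=
    fun i => HasFDerivAt.comp p
      (((EuclideanSpace.proj (𝕜 := ℂ) i).restrictScalars ℝ).hasFDerivAt) hX.hasFDerivAt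
  have h1 : HasFDerivAt (contactEq Ω i j) _ p :=
    (Complex.conjCLE.toContinuousLinearMap.hasFDerivAt.comp p
      (((hXi i).mul (hco j)).sub ((hXi j).mul (hco i)))).congr_of_eventuallyEq
      (Eventually.of_forall fun z => by simp [contactEq, gradX_apply])
  have hpi : ∀ i, p i = c * gradX Ω p i := fun i => congrArg (fun z : Cn n => z i) hc
  rw [h1.fderiv]
  simp only [ContinuousLinearMap.comp_apply, sub_apply, add_apply, smul_apply,
    ContinuousLinearMap.coe_restrictScalars', PiLp.proj_apply, hpi, smul_eq_mul,
    PiLp.sub_apply, PiLp.smul_apply]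
  change conj _ = conj _
  congr 1
  ring

/-- The common kernel of the differentials of the contact equations at a contact point. -/
theorem forall_fderiv_contactEq_eq_zero_iff (hX : DifferentiableAt ℝ (gradX Ω) p)
    (hΩ : Ω p ≠ 0) (hc : p = c • gradX Ω p) (v : Cn n) :
    (∀ i j, fderiv ℝ (contactEq Ω i j) p v = 0) ↔
      ∃ d : ℂ, v - c • fderiv ℝ (gradX Ω) p v = d • gradX Ω p := by
  simp only [fderiv_contactEq hX hc, map_eq_zero]
  set y := c • fderiv ℝ (gradX Ω) p v - v with hy
  have hy' : v - c • fderiv ℝ (gradX Ω) p v = -y := by rw [hy, neg_sub]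
  rw [hy']
  constructor
  · intro h
    obtain ⟨j, hj⟩ : ∃ j, gradX Ω p j ≠ 0 := by
      by_contra! h0
      exact hΩ (gradX_eq_zero_iff.1 (PiLp.ext h0))
    refine ⟨-(y j / gradX Ω p j), PiLp.ext fun i => ?_⟩
    have := h i j
    simp only [PiLp.neg_apply, PiLp.smul_apply, smul_eq_mul]
    field_simp
    linear_combination -this
  · rintro ⟨d, hd⟩ i j
    have h1 : y = (-d) • gradX Ω p := by rw [neg_smul, ← hd, neg_neg]
    rw [h1]
    simp only [PiLp.smul_apply, smul_eq_mul]
    ring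

/-- The component orthogonal to `p` of the contact equations: it vanishes at the points `z` near
`p` that are multiples of `grad Ω(z)`. -/
noncomputable def contactMap (Ω : Cn n → (Cn n →L[ℂ] ℂ)) (p z : Cn n) : Cn n :=
  (inner ℂ p z : ℂ) • gradX Ω z - (inner ℂ p (gradX Ω z) : ℂ) • z

theorem inner_contactMap (p z : Cn n) : inner ℂ p (contactMap Ω p z) = 0 := by
  rw [contactMap, inner_sub_right, inner_smul_right, inner_smul_right]
  ring

theorem exists_hasFDerivAt_contactMap (hX : DifferentiableAt ℝ (gradX Ω) p) :
    ∃ L : Cn n →L[ℝ] Cn n, HasFDerivAt (contactMap Ω p) L p ∧ ∀ v,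
      L v = (inner ℂ p v : ℂ) • gradX Ω p + (inner ℂ p p : ℂ) • fderiv ℝ (gradX Ω) p v -
        ((inner ℂ p (fderiv ℝ (gradX Ω) p v) : ℂ) • p + (inner ℂ p (gradX Ω p) : ℂ) • v) := by
  have h1 : ∀ z : Cn n, HasFDerivAt (fun z => (inner ℂ p z : ℂ))
      ((innerSL ℂ p).restrictScalars ℝ) z := fun z =>
    ((innerSL ℂ p).restrictScalars ℝ).hasFDerivAt
  have h2 := ((h1 p).smul hX.hasFDerivAt).sub
    (((h1 (gradX Ω p)).comp p hX.hasFDerivAt).smul (hasFDerivAt_id p))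
  refine ⟨_, h2, fun v => ?_⟩
  simp only [sub_apply, add_apply, smul_apply, ContinuousLinearMap.smulRight_apply,
    ContinuousLinearMap.comp_apply, ContinuousLinearMap.coe_restrictScalars', innerSL_apply_apply,
    ContinuousLinearMap.coe_id', id_eq, Function.comp_apply]
  rw [add_comm, add_comm (_ • v)]

/-- Modulo `ℂ p = ℂ X(p)`, the vector `c L v` is `-‖p‖² (v - c DX v)`; as `L v ⟂ p`, it vanishes as
soon as it lies in `ℂ p`. So `contactMap` alone has the same kernel as all the contact equations
together. -/
theorem fderiv_contactMap_eq_zero_iff (hp : p ≠ 0) (hc : p = c • gradX Ω p)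
    {L : Cn n →L[ℝ] Cn n} (hL : ∀ v,
      L v = (inner ℂ p v : ℂ) • gradX Ω p + (inner ℂ p p : ℂ) • fderiv ℝ (gradX Ω) p v -
        ((inner ℂ p (fderiv ℝ (gradX Ω) p v) : ℂ) • p + (inner ℂ p (gradX Ω p) : ℂ) • v))
    (v : Cn n) :
    L v = 0 ↔ ∃ d : ℂ, v - c • fderiv ℝ (gradX Ω) p v = d • gradX Ω p := by
  have hN : (inner ℂ p p : ℂ) ≠ 0 := by rwa [Ne, inner_self_eq_zero]
  have hc0 : c ≠ 0 := by
    rintro rfl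
    exact hp (by rw [hc, zero_smul])
  have hpX : c * (inner ℂ p (gradX Ω p) : ℂ) = inner ℂ p p := by
    rw [← inner_smul_right, ← hc]
  set D := fderiv ℝ (gradX Ω) p v with hD
  have h1 : c • L v = ((inner ℂ p v : ℂ) - c * inner ℂ p D) • p -
      (inner ℂ p p : ℂ) • (v - c • D) := by
    have h2 : c • (inner ℂ p v : ℂ) • gradX Ω p = (inner ℂ p v : ℂ) • p := by
      rw [smul_comm, ← hc]
    rw [hL, smul_sub, smul_add, smul_add, h2, ← hpX]
    module
  have h2 : inner ℂ p (L v) = (0 : ℂ) := by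
    rw [hL]
    simp only [inner_sub_right, inner_add_right, inner_smul_right]
    ring
  constructor
  · intro h
    rw [h, smul_zero] at h1
    refine ⟨(inner ℂ p p)⁻¹ * (((inner ℂ p v : ℂ) - c * inner ℂ p D) * c), ?_⟩
    have h3 := sub_eq_zero.1 h1.symm
    rw [mul_smul, mul_smul, ← hc, h3, smul_smul, inv_mul_cancel₀ hN, one_smul]
  · rintro ⟨d, hd⟩
    have h3 : gradX Ω p = c⁻¹ • p := by rw [eq_inv_smul_iff₀ hc0, ← hc]
    rw [hd, h3, smul_smul, smul_smul, ← sub_smul] at h1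
    have h4 : inner ℂ p (c • L v) = (0 : ℂ) := by rw [inner_smul_right, h2, mul_zero]
    rw [h1, inner_smul_right, mul_eq_zero, or_iff_left hN] at h4
    rw [h4, zero_smul] at h1
    exact (smul_eq_zero.1 h1).resolve_left hc0

/-- The real plane `ℂ p`. -/
noncomputable def complexLine (p : Cn n) : Submodule ℝ (Cn n) :=
  (Submodule.span ℂ {p}).restrictScalars ℝ

theorem mem_complexLine {p z : Cn n} : z ∈ complexLine p ↔ ∃ a : ℂ, a • p = z := by
  rw [complexLine, Submodule.restrictScalars_mem, Submodule.mem_span_singleton]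

theorem finrank_complexLine (hp : p ≠ 0) : Module.finrank ℝ (complexLine p) = 2 := by
  have h1 := finrank_real_of_complex (Submodule.span ℂ {p})
  rwa [finrank_span_singleton hp] at h1

/-- At a nondegenerate contact point the variety of contacts is flattened by a local
diffeomorphism, whose derivative there is `v ↦ ⟨p, v⟩ p + D(contactMap) v`. -/
theorem exists_contact_chart (hU : IsOpen U) (hhol : DifferentiableOn ℂ Ω U) (hpU : p ∈ U)
    (hp : p ≠ 0) (hc : p = c • gradX Ω p) {L : Cn n →L[ℝ] Cn n}
    (hL : HasFDerivAt (contactMap Ω p) L p)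
    (hinj : ∀ v, inner ℂ p v = (0 : ℂ) → L v = 0 → v = 0) :
    ∃ (e : OpenPartialHomeomorph (Cn n) (Cn n)) (e' : Cn n ≃L[ℝ] Cn n),
      p ∈ e.source ∧ ContDiffOn ℝ ∞ e e.source ∧ ContDiffOn ℝ ∞ e.symm e.target ∧
      HasFDerivAt e (e' : Cn n →L[ℝ] Cn n) p ∧ (∀ v, e' v = (inner ℂ p v : ℂ) • p + L v) ∧
      e p ∈ complexLine p ∧
      ∀ z ∈ e.source, z ∈ contactSet Ω U \ {0} ↔ e z ∈ complexLine p := by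
  have hN0 : (inner ℂ p p : ℂ) ≠ 0 := by rwa [Ne, inner_self_eq_zero]
  have hpX : (inner ℂ p (gradX Ω p) : ℂ) ≠ 0 := by
    intro h
    apply hN0
    conv_lhs => rw [hc]
    rw [inner_smul_right, ← hc, h, mul_zero]
  have hLp : ∀ v, inner ℂ p (L v) = (0 : ℂ) := by
    intro v
    have h1 : HasFDerivAt (fun z => (inner ℂ p (contactMap Ω p z) : ℂ))
        (((innerSL ℂ p).restrictScalars ℝ).comp L) p :=
      HasFDerivAt.comp p (((innerSL ℂ p).restrictScalars ℝ).hasFDerivAt) hL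
    simp only [inner_contactMap] at h1
    exact congrArg (fun T : Cn n →L[ℝ] ℂ => T v) (h1.unique (hasFDerivAt_const 0 p))
  -- `contactMap` takes values in `p^⊥`; the first summand fills the missing direction, so that `f z
  -- ∈ ℂ p` exactly when `contactMap Ω p z = 0`.
  set f : Cn n → Cn n := fun z => (inner ℂ p z : ℂ) • p + contactMap Ω p z with hf
  have hXs := contDiffOn_gradX hU hhol
  have hip : ContDiff ℝ ∞ fun z : Cn n => (inner ℂ p z : ℂ) :=
    ((innerSL ℂ p).restrictScalars ℝ).contDiff
  have hfs : ContDiffOn ℝ ∞ f U :=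
    (hip.contDiffOn.smul contDiffOn_const).add
      ((hip.contDiffOn.smul hXs).sub ((hip.comp_contDiffOn hXs).smul contDiffOn_id))
  set f' : Cn n →L[ℝ] Cn n := ((innerSL ℂ p).restrictScalars ℝ).smulRight p + L with hf'
  have hf'v : ∀ v, f' v = (inner ℂ p v : ℂ) • p + L v := fun v => rfl
  have hff' : HasFDerivAt f f' p :=
    (((innerSL ℂ p).restrictScalars ℝ).hasFDerivAt.smul_const p).add hL
  have hf'inj : Function.Injective f' := by
    rw [injective_iff_map_eq_zero]
    intro v hv
    rw [hf'v] at hv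
    have h1 : inner ℂ p v = (0 : ℂ) := by
      have h2 := congrArg (fun z => (inner ℂ p z : ℂ)) hv
      simp only [inner_add_right, inner_smul_right, hLp, add_zero, inner_zero_right,
        mul_eq_zero, or_iff_left hN0] at h2
      exact h2
    rw [h1, zero_smul, zero_add] at hv
    exact hinj v h1 hv
  let e' : Cn n ≃L[ℝ] Cn n :=
    (LinearEquiv.ofInjectiveEndo f'.toLinearMap hf'inj).toContinuousLinearEquiv
  have he'v : ∀ v, e' v = f' v := fun v => rfl
  have he' : (e' : Cn n →L[ℝ] Cn n) = f' := ContinuousLinearMap.ext he'v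
  have hfp := hfs.contDiffAt (hU.mem_nhds hpU)
  let e₀ := hfp.toOpenPartialHomeomorph f (he' ▸ hff') (by simp)
  -- The first condition makes the inverse smooth on the whole target, the second allows solving
  -- `contactMap = 0` for `z` as a multiple of `X(z)`, and the third excludes `z = 0`.
  set S : Set (Cn n) := {z ∈ U | IsUnit (fderiv ℝ f z)} ∩
    ({z ∈ U | (inner ℂ p (gradX Ω z) : ℂ) ≠ 0} ∩ {z | (inner ℂ p z : ℂ) ≠ 0}) with hS
  have hSo : IsOpen S := by
    refine IsOpen.inter ?_ (IsOpen.inter ?_ ?_)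
    · exact (hfs.continuousOn_fderiv_of_isOpen hU (by simp)).isOpen_inter_preimage hU Units.isOpen
    · exact (hip.comp_contDiffOn hXs).continuousOn.isOpen_inter_preimage hU isOpen_ne
    · exact isOpen_ne.preimage hip.continuous
  have hpS : p ∈ S := by
    refine ⟨⟨hpU, ?_⟩, ⟨hpU, hpX⟩, hN0⟩
    rw [hff'.fderiv, ← he']
    exact (ContinuousLinearEquiv.unitsEquiv ℝ (Cn n)).symm e' |>.isUnit
  have hsource : ∀ z ∈ (e₀.restrOpen S hSo).source, z ∈ S := fun z hz => hz.2
  refine ⟨e₀.restrOpen S hSo, e', ⟨?_, hpS⟩, ?_, ?_, ?_, ?_, ?_, ?_⟩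
  · exact hfp.mem_toOpenPartialHomeomorph_source (he' ▸ hff') (by simp)
  · exact hfs.mono fun z hz => (hsource z hz).1.1
  · intro y hy
    have hz := hsource _ ((e₀.restrOpen S hSo).map_target hy)
    obtain ⟨T, hT⟩ := hz.1.2
    have hfz := hfs.contDiffAt (hU.mem_nhds hz.1.1)
    refine ((e₀.restrOpen S hSo).contDiffAt_symm
      (f₀' := ContinuousLinearEquiv.unitsEquiv ℝ (Cn n) T) hy ?_ hfz).contDiffWithinAt
    have h1 := (hfz.differentiableAt (by simp)).hasFDerivAt
    rw [← hT] at h1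
    exact h1
  · rw [he']
    exact hff'
  · exact fun v => (he'v v).trans (hf'v v)
  · have h1 : contactMap Ω p p = 0 := by
      have h2 : (inner ℂ p p : ℂ) = c * inner ℂ p (gradX Ω p) := by
        rw [← inner_smul_right, ← hc]
      rw [contactMap, h2, sub_eq_zero, mul_comm, mul_smul, ← hc]
    exact mem_complexLine.2 ⟨inner ℂ p p, by
      change _ = f p
      rw [hf]
      simp only [h1, add_zero]⟩
  · intro z hz
    obtain ⟨⟨hzU, -⟩, ⟨-, hzX⟩, hzp⟩ := hsource z hz
    change _ ↔ f z ∈ complexLine p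
    constructor
    · rintro ⟨h1, -⟩
      obtain ⟨-, d, hd⟩ := contactSet_iff.1 h1
      refine mem_complexLine.2 ⟨inner ℂ p z, ?_⟩
      have h2 : (inner ℂ p z : ℂ) = d * inner ℂ p (gradX Ω z) := by
        rw [← inner_smul_right, ← hd]
      have h3 : contactMap Ω p z = 0 := by
        rw [contactMap, h2, sub_eq_zero, mul_comm, mul_smul, ← hd]
      rw [hf]
      simp only [h3, add_zero]
    · intro h1
      obtain ⟨a, ha⟩ := mem_complexLine.1 h1
      have h2 : inner ℂ p (f z) = (inner ℂ p z : ℂ) * inner ℂ p p := by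
        rw [hf]
        simp only [inner_add_right, inner_smul_right, inner_contactMap, add_zero]
      rw [← ha, inner_smul_right] at h2
      have h3 := mul_right_cancel₀ hN0 h2
      have h4 : contactMap Ω p z = 0 := by
        rw [h3] at ha
        simpa [hf] using ha
      refine ⟨contactSet_iff.2 ⟨hzU, (inner ℂ p (gradX Ω z))⁻¹ * inner ℂ p z, ?_⟩, ?_⟩
      · rw [mul_smul, sub_eq_zero.1 h4, smul_smul, inv_mul_cancel₀ hzX, one_smul]
      · rintro rfl
        exact hzp (inner_zero_right p)

/-- The tangent vectors to the variety of contacts are annihilated by the contact equations. -/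
theorem fderiv_contactEq_eq_zero_of_mem_tangentVectors
    (hX : DifferentiableAt ℝ (gradX Ω) p) {v : Cn n}
    (hv : v ∈ tangentVectors (contactSet Ω U \ {0}) p) (i j : Fin n) :
    fderiv ℝ (contactEq Ω i j) p v = 0 := by
  obtain ⟨γ, h0, hγ, hev⟩ := hv
  have hd : DifferentiableAt ℝ (contactEq Ω i j) (γ 0) := by
    rw [h0]
    have hXi : ∀ i, DifferentiableAt ℝ (fun z => gradX Ω z i) p := fun i =>
      ((EuclideanSpace.proj (𝕜 := ℂ) i).restrictScalars ℝ).differentiableAt.comp p hX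
    have hco : ∀ i, DifferentiableAt ℝ (fun z : Cn n => z i) p := fun i =>
      ((EuclideanSpace.proj (𝕜 := ℂ) i).restrictScalars ℝ).differentiableAt
    exact (Complex.conjCLE.toContinuousLinearMap.differentiableAt.comp p
      (((hXi i).mul (hco j)).sub ((hXi j).mul (hco i)))).congr_of_eventuallyEq
      (Eventually.of_forall fun z => by simp [contactEq, gradX_apply])
  have h1 := hd.hasFDerivAt.comp_hasDerivAt 0 hγ
  have h2 : (contactEq Ω i j ∘ γ) =ᶠ[𝓝 0] fun _ => (0 : ℂ) := by
    filter_upwards [hev] with t ht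
    obtain ⟨-, d, hd⟩ := contactSet_iff.1 ht.1
    have hi : ∀ i, γ t i = d * gradX Ω (γ t) i := fun i => congrArg (fun z : Cn n => z i) hd
    simp only [Function.comp_apply, contactEq, hi, gradX_apply, map_mul, Complex.conj_conj]
    ring
  have h3 := h1.unique ((hasDerivAt_const (0 : ℝ) (0 : ℂ)).congr_of_eventuallyEq h2)
  rwa [h0] at h3

end Surface

/-! ### Nondegenerate contact against a transverse surface of contacts. -/

section Characterization

variable {n : ℕ} {Ω : Cn n → (Cn n →L[ℂ] ℂ)} {U : Set (Cn n)} {p : Cn n}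

/-- Near a nondegenerate contact point the variety of contacts is a surface whose tangent plane is
the common kernel of the differentials of the contact equations and a complement of `Ker Ω`. -/
theorem ContactNondegenerate.surface_transverse_at (hU : IsOpen U) (hhol : DifferentiableOn ℂ Ω U)
    (hpS : p ∈ contactSet Ω U \ {0}) (hΩ : Ω p ≠ 0) (hND : ContactNondegenerate Ω p) :
    (∃ (e : OpenPartialHomeomorph (Cn n) (Cn n)) (W : Submodule ℝ (Cn n)),
      p ∈ e.source ∧ ContDiffOn ℝ ∞ e e.source ∧ ContDiffOn ℝ ∞ e.symm e.target ∧
      Module.finrank ℝ W = 2 ∧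
      e '' ((contactSet Ω U \ {0}) ∩ e.source) = (W : Set (Cn n)) ∩ e.target) ∧
    tangentVectors (contactSet Ω U \ {0}) p =
      {v | ∀ i j, fderiv ℝ (contactEq Ω i j) p v = 0} ∧
    ∀ x : Cn n, ∃ v ∈ tangentVectors (contactSet Ω U \ {0}) p, ∃ u : Cn n,
      Ω p u = 0 ∧ v + u = x := by
  obtain ⟨hpU, c, hc⟩ := contactSet_iff.1 hpS.1
  have hp : p ≠ 0 := hpS.2
  have hc0 : c ≠ 0 := by
    rintro rfl
    exact hp (by rw [hc, zero_smul])
  have hX := differentiableAt_gradX hU hhol hpU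
  have hker : ∀ v, inner ℂ p v = (0 : ℂ) → Ω p v = 0 := by
    intro v hv
    rw [hc, inner_smul_left, inner_gradX, mul_eq_zero] at hv
    exact hv.resolve_left (by simpa using hc0)
  obtain ⟨L, hL, hLv⟩ := exists_hasFDerivAt_contactMap (Ω := Ω) hX
  have hL0 := fderiv_contactMap_eq_zero_iff hp hc hLv
  obtain ⟨e, e', hes, he1, he2, hed, he'v, hepW, heS⟩ :=
    exists_contact_chart hU hhol hpU hp hc hL fun v hv hLv0 => by
      obtain ⟨d, hd⟩ := (hL0 v).1 hLv0
      exact hND c hc v (hker v hv) d hd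
  have htan : ∀ v, L v = 0 → v ∈ tangentVectors (contactSet Ω U \ {0}) p := by
    intro v hv
    have hsymm : HasFDerivAt e.symm (e'.symm : Cn n →L[ℝ] Cn n) (e p) := by
      refine e.hasFDerivAt_symm (e.map_source hes) ?_
      rwa [e.left_inv hes]
    -- For `L v = 0` the vector `e' v` lies in `ℂ p`, so this line stays in the flattened surface
    -- and its preimage is a curve in `Σ` with velocity `v`.
    have hline : HasDerivAt (fun t : ℝ => e p + t • e' v) (e' v) 0 := by
      simpa using ((hasDerivAt_id (0 : ℝ)).smul_const (e' v)).const_add (e p)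
    refine ⟨fun t => e.symm (e p + t • e' v), by simp [e.left_inv hes], ?_, ?_⟩
    · have h1 : HasFDerivAt e.symm (e'.symm : Cn n →L[ℝ] Cn n) (e p + (0 : ℝ) • e' v) := by
        simpa using hsymm
      have h2 := h1.comp_hasDerivAt 0 hline
      rwa [ContinuousLinearEquiv.coe_coe, e'.symm_apply_apply] at h2
    · have h1 : ∀ᶠ t in 𝓝 (0 : ℝ), e p + t • e' v ∈ e.target :=
        hline.continuousAt.eventually (e.open_target.mem_nhds (by simpa using e.map_source hes))
      filter_upwards [h1] with t ht
      rw [heS _ (e.map_target ht), e.right_inv ht]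
      refine Submodule.add_mem _ hepW (Submodule.smul_mem _ _ ?_)
      rw [he'v, hv, add_zero]
      exact mem_complexLine.2 ⟨_, rfl⟩
  refine ⟨⟨e, complexLine p, hes, he1, he2, finrank_complexLine hp, ?_⟩, ?_, ?_⟩
  · ext y
    constructor
    · rintro ⟨z, ⟨hz, hzs⟩, rfl⟩
      exact ⟨(heS z hzs).1 hz, e.map_source hzs⟩
    · rintro ⟨hy, hyt⟩
      refine ⟨e.symm y, ⟨(heS _ (e.map_target hyt)).2 ?_, e.map_target hyt⟩, e.right_inv hyt⟩
      rwa [e.right_inv hyt]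
  · ext v
    constructor
    · exact fun hv => fderiv_contactEq_eq_zero_of_mem_tangentVectors hX hv
    · exact fun hv => htan v ((hL0 v).2 ((forall_fderiv_contactEq_eq_zero_iff hX hΩ hc v).1 hv))
  · intro x
    have hN : (inner ℂ p p : ℂ) ≠ 0 := by rwa [Ne, inner_self_eq_zero]
    -- Comparing components along and orthogonal to `p` gives `⟨p, v⟩ = ⟨p, x⟩` and `L v = 0`: `v`
    -- is tangent to `Σ`, and `x - v ⟂ p` lies in `Ker Ω(p)`.
    obtain ⟨v, hv⟩ := e'.surjective ((inner ℂ p x : ℂ) • p)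
    rw [he'v] at hv
    have hpL : inner ℂ p (L v) = (0 : ℂ) := by
      rw [hLv]
      simp only [inner_sub_right, inner_add_right, inner_smul_right]
      ring
    have h1 : (inner ℂ p v : ℂ) = inner ℂ p x := by
      have h2 := congrArg (fun z => (inner ℂ p z : ℂ)) hv
      simp only [inner_add_right, inner_smul_right, hpL, add_zero] at h2
      exact mul_right_cancel₀ hN h2
    rw [h1, add_eq_left] at hv
    refine ⟨v, htan v hv, x - v, hker _ ?_, by abel⟩
    rw [inner_sub_right, h1, sub_self]

/-- A curve in a submanifold has its velocity in the tangent space of the submanifold. -/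
theorem fderiv_mem_of_mem_tangentVectors {S : Set (Cn n)}
    {e : OpenPartialHomeomorph (Cn n) (Cn n)} {W : Submodule ℝ (Cn n)} (hp : p ∈ e.source)
    (hpS : p ∈ S) (he : DifferentiableAt ℝ e p)
    (heS : e '' (S ∩ e.source) = (W : Set (Cn n)) ∩ e.target) {v : Cn n}
    (hv : v ∈ tangentVectors S p) : fderiv ℝ e p v ∈ W := by
  obtain ⟨γ, h0, hγ, hev⟩ := hv
  subst h0
  have hmem : ∀ z ∈ S, z ∈ e.source → e z ∈ W := fun z hz hzs =>
    (heS.subset ⟨z, ⟨hz, hzs⟩, rfl⟩).1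
  -- The difference quotients of `e ∘ γ` lie in `W`, which is closed.
  have h1 := (he.hasFDerivAt.comp_hasDerivAt 0 hγ).tendsto_slope
  refine W.closed_of_finiteDimensional.mem_of_tendsto h1 ?_
  have h2 : ∀ᶠ t in 𝓝 (0 : ℝ), γ t ∈ e.source :=
    hγ.continuousAt.eventually (e.open_source.mem_nhds hp)
  filter_upwards [hev.filter_mono nhdsWithin_le_nhds, h2.filter_mono nhdsWithin_le_nhds]
    with t ht hts
  exact W.smul_mem _ (W.sub_mem (hmem _ ht hts) (hmem _ hpS hp))

/-- A degenerate direction `u` lies both in `Ker Ω(p)` and in the common kernel `T` of the contact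
differentials. Now `dim T ≤ 2`, `dim Ker Ω(p) = 2n - 2`, and the two span `ℝ²ⁿ`, so they meet only
in `0`. -/
theorem contactNondegenerate_of_surface_transverse (hU : IsOpen U)
    (hhol : DifferentiableOn ℂ Ω U) (hS : ContactVarietyIsSurface Ω U)
    (hT : IsTransverse Ω U (contactSet Ω U \ {0})) (hpS : p ∈ contactSet Ω U \ {0})
    (hΩ : Ω p ≠ 0) : ContactNondegenerate Ω p := by
  intro c hc u hu d hd
  have hpU := (contactSet_iff.1 hpS.1).1
  have hX := differentiableAt_gradX hU hhol hpU
  obtain ⟨e, W, hes, he1, he2, hW, heS⟩ := hS.1 p hpS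
  have htan := hS.2 p hpS
  have hed : DifferentiableAt ℝ e p :=
    (he1.contDiffAt (e.open_source.mem_nhds hes)).differentiableAt (by simp)
  have hesd : DifferentiableAt ℝ e.symm (e p) :=
    (he2.contDiffAt (e.open_target.mem_nhds (e.map_source hes))).differentiableAt (by simp)
  have heinj : Function.Injective (fderiv ℝ e p) := by
    have h1 := hesd.hasFDerivAt.comp p hed.hasFDerivAt
    have h2 : (e.symm ∘ e) =ᶠ[𝓝 p] id := by
      filter_upwards [e.open_source.mem_nhds hes] with z hz using e.left_inv hz
    have h3 := h1.unique ((hasFDerivAt_id p).congr_of_eventuallyEq h2)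
    intro a b hab
    have h4 : ∀ x, fderiv ℝ e.symm (e p) (fderiv ℝ e p x) = x := fun x =>
      congrArg (fun T : Cn n →L[ℝ] Cn n => T x) h3
    rw [← h4 a, hab, h4 b]
  let T : Submodule ℝ (Cn n) :=
    ⨅ i, ⨅ j, LinearMap.ker (fderiv ℝ (contactEq Ω i j) p).toLinearMap
  have hTmem : ∀ v, v ∈ T ↔ v ∈ tangentVectors (contactSet Ω U \ {0}) p := by
    intro v
    rw [htan]
    simp [T, Submodule.mem_iInf]
  -- The derivative of the flattening chart is injective and maps tangent vectors into `W`.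
  have hTfin : Module.finrank ℝ T ≤ 2 := by
    rw [← hW]
    refine LinearMap.finrank_le_finrank_of_injective
      (f := ((fderiv ℝ e p).toLinearMap.restrict (p := T) (q := W) fun v hv =>
        fderiv_mem_of_mem_tangentVectors hes hpS hed heS ((hTmem v).1 hv))) ?_
    intro a b hab
    exact Subtype.ext (heinj (congrArg Subtype.val hab))
  let K : Submodule ℝ (Cn n) := (LinearMap.ker (Ω p).toLinearMap).restrictScalars ℝ
  have hKfin : Module.finrank ℝ K + 2 = 2 * n := by
    have h1 : Module.finrank ℝ K = 2 * Module.finrank ℂ (LinearMap.ker (Ω p).toLinearMap) :=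
      finrank_real_of_complex (LinearMap.ker (Ω p).toLinearMap)
    have h2 := finrank_ker_add_one hΩ
    omega
  have htop : T ⊔ K = ⊤ := by
    refine eq_top_iff.2 fun x _ => ?_
    obtain ⟨v, hv, u, hu, rfl⟩ := hT.2 p hpS x
    exact Submodule.add_mem_sup ((hTmem v).2 hv) hu
  have hinf : T ⊓ K = ⊥ := by
    have h1 := Submodule.finrank_sup_add_finrank_inf_eq T K
    rw [htop, finrank_top, finrank_real_of_complex, finrank_euclideanSpace_fin] at h1
    exact Submodule.finrank_eq_zero.1 (by omega)
  have huT : u ∈ T := by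
    rw [hTmem, htan]
    exact (forall_fderiv_contactEq_eq_zero_iff hX hΩ hc u).2 ⟨d, hd⟩
  have : u ∈ T ⊓ K := ⟨huT, hu⟩
  rwa [hinf, Submodule.mem_bot] at this

end Characterization

end MorseFoliation

theorem mainTheorem3 (n : ℕ) (hn : 2 ≤ n)
    (U : Set (MorseFoliation.Cn n)) (hU : IsOpen U)
    (hdisk : Metric.closedBall (0 : MorseFoliation.Cn n) 1 ⊆ U)
    (Ω : MorseFoliation.Cn n → (MorseFoliation.Cn n →L[ℂ] ℂ))
    (hhol : DifferentiableOn ℂ Ω U)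
    (hint : MorseFoliation.Integrable Ω U)
    (hsing : MorseFoliation.Sing Ω U = {0}) :
    List.TFAE
      [MorseFoliation.IsMorseType Ω U,
       MorseFoliation.ContactVarietyIsSurface Ω U ∧
         MorseFoliation.IsTransverse Ω U (MorseFoliation.contactSet Ω U \ {0}),
       MorseFoliation.ProjFieldNondegenerate Ω U] := by
  -- Identifies the regular points, where plaques exist, with the points of `U` other than `0`, as
  -- used for `Σ \ {0}`.
  have hreg : ∀ z ∈ U, Ω z ≠ 0 ↔ z ≠ 0 := fun z hz => by
    have h1 : z ∈ MorseFoliation.Sing Ω U ↔ z = 0 := by rw [hsing, mem_singleton_iff]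
    rw [Ne, Ne, ← h1]
    exact not_congr ⟨fun h => ⟨hz, h⟩, fun h => h.2⟩
  tfae_have 1 ↔ 3 := MorseFoliation.isMorseType_iff_projFieldNondegenerate hU hhol
  tfae_have 1 → 2 := by
    intro h
    rw [MorseFoliation.isMorseType_iff hU hhol hint] at h
    have key := fun p (hp : p ∈ MorseFoliation.contactSet Ω U \ {0}) =>
      (h p hp.1 ((hreg p hp.1.1).2 hp.2)).surface_transverse_at hU hhol hp
        ((hreg p hp.1.1).2 hp.2)
    refine ⟨⟨fun p hp => (key p hp).1, fun p hp => (key p hp).2.1⟩, ?_,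
      fun p hp => (key p hp).2.2⟩
    rw [hsing]
    ext z
    simp
  tfae_have 2 → 1 := by
    rintro ⟨hS, hT⟩
    rw [MorseFoliation.isMorseType_iff hU hhol hint]
    exact fun p hp hΩ => MorseFoliation.contactNondegenerate_of_surface_transverse hU hhol hS hT
      ⟨hp, (hreg p hp.1).1 hΩ⟩ hΩ
  tfae_finish
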